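/- **Setting.** Let $\kappa>0$, $\Lambda>0$, and let $M=\{x\in\mathbb R^4:1<|x|<2\}\cong S^3\times(0,1)$, with the standard orientation, foliated by the slices $C_t=\{|x|=t\}\cong S^3$ (oriented by the outward normal); $t\to1$ is past infinity $\mathscr I^-$ and $t\to2$ is future infinity $\mathscr I^+$. Forms are smooth and complex valued on $M$. Spinor indices $A,B,\dots\in\{0,1\}$ are raised and lowered by $\xi^A=\varepsilon^{AB}\xi_B$, $\xi_B=\xi^A\varepsilon_{AB}$, $\varepsilon^{01}=\varepsilon_{01}=1$; round brackets denote symmetrization with weight one; repeated indices are summed. A *self-dual background* is a pair of symmetric spinor-valued forms, 2-forms $\Sigma_0^{AB}$ and connection 1-forms $\Gamma_{0\,AB}$, with $$D_0\Sigma_0^{AB}=0,\qquad F_{0\,AB}=\tfrac{\Lambda}{3}\Sigma_{0\,AB},\qquad \Sigma_0^{(AB}\wedge\Sigma_0^{CD)}=0 .$$ Here $D_0\alpha^{AB}=d\alpha^{AB}+2\Gamma_0{}^{(A}{}_C\wedge\alpha^{B)C}$ and $F_{0\,AB}=d\Gamma_{0\,AB}+\Gamma_{0\,AC}\wedge\Gamma_0{}^C{}_B$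 is the curvature of $D_0$. (Nondegeneracy of $\Sigma_0$ is not needed.) A *linearized solution* is $h=(\sigma^{AB},\gamma_{AB})$, symmetric 2- and 1-forms, with a totally symmetric smooth $\psi_{ABCD}$, such that $$D_0\sigma^{AB}=-2\gamma^{(A}{}_C\wedge\Sigma_0^{B)C},\qquad D_0\gamma_{AB}=\psi_{ABCD}\Sigma_0^{CD}+\tfrac{\Lambda}{3}\sigma_{AB},\qquad \sigma^{(AB}\wedge\Sigma_0^{CD)}=0 .$$ Let $W$ be any set of linearized solutions (the admitted states; $W$ may consist of all of them). A solution $h=(\sigma,\gamma)$ is *anti-self-dual (ASD) at $\mathscr I^\pm$ relative to $W$* if $\int_{C_t}\sigma^{AB}\wedge\gamma'_{AB}\to0$ as $C_t\to\mathscr I^\pm$ for every $(\sigma',\gamma')\in W$. For linearized solutions $h_1,h_2$ put $$\langle h_2|h_1\rangle=-\frac{i}{\kappa^2}\int_{\mathscr I^+}\sigma_1^{AB}\wedge\gamma_{2\,AB}:=-\frac{i}{\kappa^2}\lim_{t\to2}\int_{C_t}\sigma_1^{AB}\wedge\gamma_{2\,AB}$$ when the limit exists. The integral $\int_M$ of a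 4-form is understood as the limit of its integrals over $\{s<|x|<t\}$ as $s\to1$, $t\to2$. A linearized solution is *pure gauge* if $\psi=0$ and, for some smooth complex vector field $\xi$ and symmetric smooth functions $\theta_{AB}$ on $M$, $$\sigma^{AB}=\mathcal L_\xi\Sigma_0^{AB}+2\theta^{(A}{}_C\Sigma_0^{B)C},\qquad \gamma_{AB}=\mathcal L_\xi\Gamma_{0\,AB}-D_0\theta_{AB},$$ i.e. it is generated by an infinitesimal diffeomorphism and an infinitesimal rotation of the spin frame. **Proposition.** Let $h_1,h_2\in W$, with $h_1$ ASD at $\mathscr I^-$ relative to $W$. 1. The generating functional $I=\langle h_2|h_1\rangle$ exists if and only if the following bulk integral exists, and then $$\langle h_2|h_1\rangle=\frac{i}{\kappa^2}\int_M\Big(2\,\Sigma_0^{AB}\wedge\gamma_{1\,A}{}^{C}\wedge\gamma_{2\,CB}-\frac{\Lambda}{3}\,\sigma_1^{AB}\wedge\sigma_{2\,AB}\Big).$$ If the integrand is Lebesgue integrable on $M$, both exist, and the right side is the Lebesgue integral over $M$. 2. Suppose also that $h_2$ is ASD at $\mathscr I^+$ relative to $W$. If $h_1$ or $h_2$ is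 pure gauge, the bulk integral exists and vanishes. 3. Suppose again that $h_2$ is ASD at $\mathscr I^+$ relative to $W$. If only $\psi_1=0$ is known, the bulk integral exists and equals $-\frac{3i}{\Lambda\kappa^2}\int_{C_t}\gamma_1^{AB}\wedge\psi_{2\,ABCD}\Sigma_0^{CD}$ for every $t\in(1,2)$; it vanishes if and only if $\int_{C_t}\sigma_2^{AB}\wedge\gamma_{1\,AB}\to0$ at $\mathscr I^-$. If only $\psi_2=0$ is known, the bulk integral exists and equals $+\frac{3i}{\Lambda\kappa^2}\int_{C_t}\gamma_2^{AB}\wedge\psi_{1\,ABCD}\Sigma_0^{CD}$ for every $t\in(1,2)$. -/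

import Mathlib

open scoped ContDiff Topology
open MeasureTheory Filter

noncomputable section

namespace MHV

/-! ### Complex differential forms on the space-time manifold -/

/-- Ambient `ℝ⁴`, with its Euclidean structure used only to describe the manifold
`S³ × (0,1)`; it plays no role as a space-time metric. -/
abbrev E4 : Type := EuclideanSpace ℝ (Fin 4)

/-- Complex-valued alternating `k`-linear forms on the tangent space `ℝ⁴`. -/
abbrev Form (k : ℕ) : Type := E4 [⋀^Fin k]→L[ℝ] ℂ

/-- The standard oriented basis of `ℝ⁴`. -/
def stdVec (i : Fin 4) : E4 := EuclideanSpace.single i 1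

/-- The open shell `s < |x| < t`. -/
def shell (s t : ℝ) : Set E4 := {x | s < ‖x‖ ∧ ‖x‖ < t}

/-- The space-time manifold `M = {1 < |x| < 2}`, diffeomorphic to `S³ × (0,1)` by
`x ↦ (x/|x|, |x| - 1)`. The slices `|x| = t` foliate it; `t → 1` is past infinity and `t → 2` is
future infinity. -/
def spacetime : Set E4 := shell 1 2

/-- The tensor product `v ↦ α (v₁, …, v_k) β (v_{k+1}, …, v_{k+l})`. -/
def tensorForm {k l m : ℕ} (h : k + l = m) (α : Form k) (β : Form l) :
    ContinuousMultilinearMap ℝ (fun _ : Fin m => E4) ℂ where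
  toMultilinearMap :=
    ((LinearMap.mul' ℝ ℂ).compMultilinearMap
      (MultilinearMap.domCoprod α.toMultilinearMap β.toMultilinearMap)).domDomCongr
        (finSumFinEquiv.trans (finCongr h))
  cont := by
    have h1 : Continuous fun v : Fin m → E4 =>
        α (fun i => v (Fin.cast h (Fin.castAdd l i))) *
          β (fun j => v (Fin.cast h (Fin.natAdd k j))) := by
      fun_prop
    exact h1

theorem tensorForm_apply {k l m : ℕ} (h : k + l = m) (α : Form k) (β : Form l)
    (v : Fin m → E4) :
    tensorForm h α β v =
      α (fun i => v (Fin.cast h (Fin.castAdd l i))) *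
        β (fun j => v (Fin.cast h (Fin.natAdd k j))) := rfl

/-- The exterior product, normalised so that
`(α ∧ β)(v) = (k! l!)⁻¹ ∑_π sign(π) α(v_{π 1}, …, v_{π k}) β(v_{π (k+1)}, …, v_{π (k+l)})`. -/
def wedge {k l m : ℕ} (α : Form k) (β : Form l) (h : k + l = m := by omega) : Form m :=
  ((k.factorial : ℝ) * (l.factorial : ℝ))⁻¹ •
    ContinuousMultilinearMap.alternatization (tensorForm h α β)

/-- Contraction of a form with a complex tangent vector `X + iY`. -/
def contract {k : ℕ} (X Y : E4) (α : Form (k + 1)) : Form k :=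
  α.curryLeft X + Complex.I • α.curryLeft Y

/-- The Lie derivative along the complex vector field `X + iY`, by Cartan's formula. -/
def lieDeriv {k : ℕ} (X Y : E4 → E4) (α : E4 → Form (k + 1)) (x : E4) : Form (k + 1) :=
  extDeriv (fun y => contract (X y) (Y y) (α y)) x + contract (X x) (Y x) (extDeriv α x)

/-! ### Integration -/

/-- The integral of a `3`-form over the slice `C_t = {|x| = t}`, oriented as the boundary of
`{|x| < t}`: in terms of the outward unit normal `n` it is
`∫ (n♭ ∧ α)(e₀, e₁, e₂, e₃) dA`, with `dA = t³ dω`, `dω` the surface measure of the unit sphere. -/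
def sliceIntegral (t : ℝ) (α : E4 → Form 3) : ℂ :=
  (t ^ 3 : ℝ) * ∫ n : Metric.sphere (0 : E4) 1,
    ∑ i : Fin 4, ((-1 : ℂ) ^ (i : ℕ)) * (((n : E4) i : ℝ) : ℂ) *
      α (t • (n : E4)) (fun j : Fin 3 => stdVec (i.succAbove j))
    ∂((volume : Measure E4).toSphere)

/-- The density of a `4`-form with respect to the oriented volume `dx⁰ ∧ dx¹ ∧ dx² ∧ dx³`. -/
def density (α : E4 → Form 4) (x : E4) : ℂ := α x stdVec

/-- The (possibly improper) integral of a `4`-form over `M` exists and is `I`: the integrals over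
the regions between two slices converge to `I` as the slices go to past and future infinity. -/
def HasBulkIntegral (α : E4 → Form 4) (I : ℂ) : Prop :=
  Tendsto (fun p : ℝ × ℝ => ∫ x in shell p.1 p.2, density α x)
    (𝓝[>] (1 : ℝ) ×ˢ 𝓝[<] (2 : ℝ)) (𝓝 I)

/-! ### Two-component spinors -/

/-- The antisymmetric spinor `ε^{AB}`, also `ε_{AB}`, with `ε^{01} = ε_{01} = 1`; indices are
raised and lowered by `ξ^A = ε^{AB} ξ_B`, `ξ_B = ξ^A ε_{AB}`. -/
def eps (A B : Fin 2) : ℂ := if A = B then 0 else if A = 0 then 1 else -1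

/-- Two-index spinor-valued `k`-forms. -/
abbrev SpinForm (k : ℕ) : Type := Fin 2 → Fin 2 → E4 → Form k

/-- `α^{AB}` from `α_{AB}`. -/
def raise {k : ℕ} (α : SpinForm k) : SpinForm k :=
  fun A B x => ∑ C, ∑ D, (eps A C * eps B D) • α C D x

/-- `α_{AB}` from `α^{AB}`. -/
def lower {k : ℕ} (α : SpinForm k) : SpinForm k :=
  fun A B x => ∑ C, ∑ D, (eps C A * eps D B) • α C D x

/-- `α^A{}_B` from `α_{AB}`. For symmetric `α` it is also `α_B{}^A`. -/
def mixed {k : ℕ} (α : SpinForm k) : SpinForm k :=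
  fun A B x => ∑ C, eps A C • α C B x

/-- Symmetric in the two indices and smooth on `M`. -/
def IsSymmSmooth {k : ℕ} (α : SpinForm k) : Prop :=
  (∀ A B, α A B = α B A) ∧ ∀ A B, ContDiffOn ℝ ∞ (α A B) spacetime

/-- `2 β^{(A}{}_C ∧ α^{B)C}`, for `β_{AB}` and `α^{AB}`. -/
def spinAct {k l m : ℕ} (β : SpinForm k) (α : SpinForm l) (h : k + l = m := by omega) :
    SpinForm m :=
  fun A B x => ∑ C, (wedge (mixed β A C x) (α B C x) h + wedge (mixed β B C x) (α A C x) h)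

/-- `D α^{AB} = d α^{AB} + 2 Γ^{(A}{}_C ∧ α^{B)C}`. -/
def covDerivUp {k : ℕ} (Γ : SpinForm 1) (α : SpinForm k) : SpinForm (k + 1) :=
  fun A B x => extDeriv (α A B) x + spinAct Γ α (by omega) A B x

/-- `D α_{AB} = d α_{AB} - Γ^C{}_A ∧ α_{CB} - Γ^C{}_B ∧ α_{AC}`. -/
def covDerivDown {k : ℕ} (Γ : SpinForm 1) (α : SpinForm k) : SpinForm (k + 1) :=
  fun A B x => extDeriv (α A B) x
    - ∑ C, (wedge (mixed Γ C A x) (α C B x) (by omega)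
      + wedge (mixed Γ C B x) (α A C x) (by omega))

/-- The curvature `F_{AB} = d Γ_{AB} + Γ_{AC} ∧ Γ^C{}_B` of the connection `D`. -/
def curvature (Γ : SpinForm 1) : SpinForm 2 :=
  fun A B x => extDeriv (Γ A B) x + ∑ C, wedge (Γ A C x) (mixed Γ C B x)

/-- `α^{(AB} ∧ β^{CD)} = 0` on `M`. -/
def SymWedgeZero (α β : SpinForm 2) : Prop :=
  ∀ x ∈ spacetime, ∀ I : Fin 4 → Fin 2,
    ∑ π : Equiv.Perm (Fin 4),
      (wedge (α (I (π 0)) (I (π 1)) x) (β (I (π 2)) (I (π 3)) x) : Form 4) = 0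

/-- `Σ^{AB} ∧ α¹_A{}^C ∧ α²_{CB}`. -/
def cubic (Sig : SpinForm 2) (α₁ α₂ : SpinForm 1) : E4 → Form 4 :=
  fun x => ∑ A, ∑ B, ∑ C,
    wedge (Sig A B x) (wedge (mixed α₁ C A x) (α₂ C B x) : Form 2)

/-- `α^{AB} ∧ β_{AB}`, for `α` with upper and `β` with lower indices. -/
def pair {k l m : ℕ} (α : SpinForm k) (β : SpinForm l) (h : k + l = m := by omega) :
    E4 → Form m :=
  fun x => ∑ A, ∑ B, wedge (α A B x) (β A B x) h

/-- Four-index spinor fields `ψ_{ABCD}`. -/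
abbrev WeylSpinor : Type := Fin 2 → Fin 2 → Fin 2 → Fin 2 → E4 → ℂ

/-- Totally symmetric and smooth on `M`. -/
def IsWeyl (ψ : WeylSpinor) : Prop :=
  (∀ A B C D, ψ A B C D = ψ B A C D ∧ ψ A B C D = ψ A C B D ∧ ψ A B C D = ψ A B D C) ∧
    ∀ A B C D, ContDiffOn ℝ ∞ (ψ A B C D) spacetime

/-- `ψ_{ABCD} Σ^{CD}`. -/
def weylAct (ψ : WeylSpinor) (Sig : SpinForm 2) : SpinForm 2 :=
  fun A B x => ∑ C, ∑ D, ψ A B C D x • Sig C D x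

/-! ### Self-dual backgrounds and linearised solutions -/

/-- The pair `(Σ₀^{AB}, Γ₀_{AB})`. -/
structure Background where
  /-- the `2`-forms `Σ₀^{AB}` -/
  Sig : SpinForm 2
  /-- the connection `1`-forms `Γ₀_{AB}` -/
  Gam : SpinForm 1

/-- `(Σ₀, Γ₀)` solves the field equations with cosmological constant `Λ` and vanishing
anti-self-dual Weyl spinor:
`D Σ₀^{AB} = 0`, `F₀_{AB} = (Λ/3) Σ₀_{AB}`, `Σ₀^{(AB} ∧ Σ₀^{CD)} = 0`. -/
structure Background.IsSelfDual (Λ : ℝ) (b : Background) : Prop where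
  sig_symm_smooth : IsSymmSmooth b.Sig
  gam_symm_smooth : IsSymmSmooth b.Gam
  torsion_free : ∀ x ∈ spacetime, ∀ A B, covDerivUp b.Gam b.Sig A B x = 0
  curv : ∀ x ∈ spacetime, ∀ A B,
    curvature b.Gam A B x = ((Λ / 3 : ℝ) : ℂ) • lower b.Sig A B x
  tetrad : SymWedgeZero b.Sig b.Sig

/-- A perturbation `h = (σ^{AB}, γ_{AB})` with its linearised Weyl spinor `ψ_{ABCD}`. -/
structure State where
  /-- the perturbation `σ^{AB}` of `Σ₀^{AB}` -/
  sig : SpinForm 2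
  /-- the perturbation `γ_{AB}` of `Γ₀_{AB}` -/
  gam : SpinForm 1
  /-- the linearised anti-self-dual Weyl spinor `ψ_{ABCD}` -/
  psi : WeylSpinor

/-- The linearised field equations
`D₀ σ^{AB} = -2 γ^{(A}{}_C ∧ Σ₀^{B)C}`, `D₀ γ_{AB} = ψ_{ABCD} Σ₀^{CD} + (Λ/3) σ_{AB}`,
`σ^{(AB} ∧ Σ₀^{CD)} = 0`. -/
structure State.IsSolution (Λ : ℝ) (b : Background) (h : State) : Prop where
  sig_symm_smooth : IsSymmSmooth h.sig
  gam_symm_smooth : IsSymmSmooth h.gam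
  psi_weyl : IsWeyl h.psi
  torsion : ∀ x ∈ spacetime, ∀ A B,
    covDerivUp b.Gam h.sig A B x = -spinAct h.gam b.Sig (m := 3) (by omega) A B x
  curv : ∀ x ∈ spacetime, ∀ A B,
    covDerivDown b.Gam h.gam A B x =
      weylAct h.psi b.Sig A B x + ((Λ / 3 : ℝ) : ℂ) • lower h.sig A B x
  tetrad : SymWedgeZero h.sig b.Sig

/-- `h` has vanishing linearised anti-self-dual Weyl spinor on `M`. -/
def State.WeylFree (h : State) : Prop :=
  ∀ x ∈ spacetime, ∀ A B C D, h.psi A B C D x = 0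

/-- `h` is pure gauge: the variation of `(Σ₀, Γ₀)` under an infinitesimal diffeomorphism, along a
complex vector field `X + iY`, and an infinitesimal rotation `θ_{AB}` of the spin frame:
`σ = £ Σ₀ + 2 θ^{(A}{}_C Σ₀^{B)C}`, `γ = £ Γ₀ - D₀ θ`, and `ψ = 0`. -/
def State.IsPureGauge (b : Background) (h : State) : Prop :=
  h.WeylFree ∧
  ∃ (X Y : E4 → E4) (θ : SpinForm 0),
    ContDiffOn ℝ ∞ X spacetime ∧ ContDiffOn ℝ ∞ Y spacetime ∧ IsSymmSmooth θ ∧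
    ∀ x ∈ spacetime, ∀ A B,
      h.sig A B x = lieDeriv X Y (b.Sig A B) x + spinAct θ b.Sig (m := 2) (by omega) A B x ∧
      h.gam A B x = lieDeriv X Y (b.Gam A B) x - covDerivDown b.Gam θ A B x

/-! ### Boundary pairings and the bulk expression -/

/-- `∫_{C_t} σ^{AB} ∧ γ_{AB}` with `σ` from `h` and `γ` from `k`. -/
def slicePairing (t : ℝ) (h k : State) : ℂ :=
  sliceIntegral t (pair h.sig k.gam)

/-- The inner product `⟨h|k⟩ = -(i/κ²) ∫_{C_t} σ_k^{AB} ∧ γ_{h AB}` on the slice `C_t`. -/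
def inner (κ t : ℝ) (h k : State) : ℂ :=
  -(Complex.I / (κ : ℂ) ^ 2) * slicePairing t k h

/-- The generating functional `⟨h|k⟩` at future infinity exists and is `I`. -/
def HasAmplitude (κ : ℝ) (h k : State) (I : ℂ) : Prop :=
  Tendsto (fun t => inner κ t h k) (𝓝[<] (2 : ℝ)) (𝓝 I)

/-- `h` is anti-self-dual at past infinity, relative to the space `W` of test states. -/
def IsASDPast (W : Set State) (h : State) : Prop :=
  ∀ k ∈ W, Tendsto (fun t => slicePairing t h k) (𝓝[>] (1 : ℝ)) (𝓝 0)

/-- `h` is anti-self-dual at future infinity, relative to the space `W` of test states. -/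
def IsASDFuture (W : Set State) (h : State) : Prop :=
  ∀ k ∈ W, Tendsto (fun t => slicePairing t h k) (𝓝[<] (2 : ℝ)) (𝓝 0)

/-- The `4`-form
`(i/κ²) (2 Σ₀^{AB} ∧ γ₁_A{}^C ∧ γ₂_{CB} - (Λ/3) σ₁^{AB} ∧ σ₂_{AB})`. -/
def bulkForm (κ Λ : ℝ) (b : Background) (h₁ h₂ : State) : E4 → Form 4 :=
  fun x => (Complex.I / (κ : ℂ) ^ 2) •
    ((2 : ℂ) • cubic b.Sig h₁.gam h₂.gam x
      - ((Λ / 3 : ℝ) : ℂ) • pair h₁.sig (lower h₂.sig) (m := 4) (by omega) x)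

/-- The flux `∫_{C_t} γ_h^{AB} ∧ ψ_{k ABCD} Σ₀^{CD}`. -/
def weylFlux (b : Background) (t : ℝ) (h k : State) : ℂ :=
  sliceIntegral t (pair (raise h.gam) (weylAct k.psi b.Sig))

end MHV

end

noncomputable section
namespace MHV

/-! ### Explicit exterior products -/

/-! Write Q_t(h,k) = ∫_{C_t} σ_h^{AB} ∧ γ_{k AB}. Differentiating covariantly, d(σ₁ ∧ γ₂) = D₀σ₁ ∧
γ₂ + σ₁ ∧ D₀γ₂. The torsion equation turns the first term into the cubic term in Σ₀, γ₁, γ₂. The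
curvature equation turns the second into (Λ/3) σ₁ ∧ σ₂ plus a Weyl term, which vanishes because ψ₂
is totally symmetric and σ₁^{(AB} ∧ Σ₀^{CD)} = 0. So the bulk form is -(i/κ²) d(σ₁ ∧ γ₂)
(`extDeriv_pair_sig_gam`). Stokes' theorem on shells and the decay of Q_s(h₁,h₂) as s → 1 give the
first claim (`hasBulkIntegral_iff_tendsto`).

The bulk form is symmetric in the two solutions, so Q_t(h₁,h₂) - Q_t(h₂,h₁) does not depend on t.
Since Q(h₁,h₂) → 0 in the past and Q(h₂,h₁) → 0 in the future, the bulk integral is -(i/κ²) times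
this conserved number (`hasBulkIntegral_symplectic`). Up to an exact form, the curvature equation
equates Λ/3 times its integrand with γ₁ ∧ ψ₂Σ₀ - γ₂ ∧ ψ₁Σ₀ (`pair_sub_pair`). The slices are closed,
so the number is a difference of two Weyl fluxes (`slicePairing_sub`), and one of them drops out
when ψ₁ or ψ₂ vanishes.

For pure gauge, Cartan's formula gives γ = (Λ/3) ι_ξΣ₀ - D₀τ with τ = θ - ι_ξΓ₀. The first part
wedges to zero with ψΣ₀ by the contracted constraint (`contract_weylAct_eq_zero`). The second gives
an exact form by the linearised Bianchi identity D₀(ψΣ₀) = 0 (`covDerivDown_weylAct`). Hence the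
remaining flux vanishes too. -/

/-- Sorting permutations by the image `p` of `0` with `decomposeFin` leaves a transposition of `0`
and `p`, which costs a sign unless `p = 0`. Iterating this expands the sums over S₃ and S₄. -/
theorem sum_perm_succ {n : ℕ} (F : (Fin (n + 1) → Fin (n + 1)) → ℂ) :
    ∑ σ : Equiv.Perm (Fin (n + 1)), Equiv.Perm.sign σ • F σ =
      ∑ p : Fin (n + 1), (if p = 0 then 1 else -1) * ∑ e : Equiv.Perm (Fin n),
        Equiv.Perm.sign e • F (Fin.cons p fun j => Equiv.swap 0 p (e j).succ) := by
  rw [Finset.univ_perm_fin_succ, Finset.sum_map, ← Finset.univ_product_univ, Finset.sum_product]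
  refine Finset.sum_congr rfl fun p _ => ?_
  rw [Finset.mul_sum]
  refine Finset.sum_congr rfl fun e _ => ?_
  have h : (⇑(Equiv.Perm.decomposeFin.symm (p, e)) : Fin (n + 1) → Fin (n + 1)) =
      Fin.cons p fun j => Equiv.swap 0 p (e j).succ := by
    funext j
    refine Fin.cases ?_ (fun j => ?_) j <;> simp
  rw [Equiv.toEmbedding_apply, h, Equiv.Perm.decomposeFin.symm_sign]
  split_ifs <;> simp

theorem sum_perm_two (g : Fin 2 → Fin 2 → ℂ) :
    ∑ σ : Equiv.Perm (Fin 2), Equiv.Perm.sign σ • g (σ 0) (σ 1) = g 0 1 - g 1 0 := by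
  simp [Finset.univ_perm_fin_succ, ← Finset.univ_product_univ, Fin.sum_univ_succ]
  ring

theorem sum_perm_three (g : Fin 3 → Fin 3 → Fin 3 → ℂ) :
    ∑ σ : Equiv.Perm (Fin 3), Equiv.Perm.sign σ • g (σ 0) (σ 1) (σ 2) =
      g 0 1 2 - g 0 2 1 + g 1 2 0 - g 1 0 2 + g 2 0 1 - g 2 1 0 := by
  refine (sum_perm_succ fun v => g (v 0) (v 1) (v 2)).trans ?_
  refine (Finset.sum_congr rfl fun p _ => congrArg _ (sum_perm_two fun a b =>
    g p (Equiv.swap 0 p a.succ) (Equiv.swap 0 p b.succ))).trans ?_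
  refine (Fin.sum_univ_three _).trans ?_
  change 1 * (g 0 1 2 - g 0 2 1) + -1 * (g 1 0 2 - g 1 2 0) + -1 * (g 2 1 0 - g 2 0 1) = _
  ring

theorem sum_perm_four (g : Fin 4 → Fin 4 → Fin 4 → Fin 4 → ℂ) :
    ∑ σ : Equiv.Perm (Fin 4), Equiv.Perm.sign σ • g (σ 0) (σ 1) (σ 2) (σ 3) =
      (g 0 1 2 3 - g 0 1 3 2 + g 0 2 3 1 - g 0 2 1 3 + g 0 3 1 2 - g 0 3 2 1)
      - (g 1 0 2 3 - g 1 0 3 2 + g 1 2 3 0 - g 1 2 0 3 + g 1 3 0 2 - g 1 3 2 0)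
      - (g 2 1 0 3 - g 2 1 3 0 + g 2 0 3 1 - g 2 0 1 3 + g 2 3 1 0 - g 2 3 0 1)
      - (g 3 1 2 0 - g 3 1 0 2 + g 3 2 0 1 - g 3 2 1 0 + g 3 0 1 2 - g 3 0 2 1) := by
  refine (sum_perm_succ fun v => g (v 0) (v 1) (v 2) (v 3)).trans ?_
  refine (Finset.sum_congr rfl fun p _ => congrArg _ (sum_perm_three fun a b c =>
    g p (Equiv.swap 0 p a.succ) (Equiv.swap 0 p b.succ) (Equiv.swap 0 p c.succ))).trans ?_
  refine (Fin.sum_univ_four _).trans ?_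
  change 1 * (g 0 1 2 3 - g 0 1 3 2 + g 0 2 3 1 - g 0 2 1 3 + g 0 3 1 2 - g 0 3 2 1)
      + -1 * (g 1 0 2 3 - g 1 0 3 2 + g 1 2 3 0 - g 1 2 0 3 + g 1 3 0 2 - g 1 3 2 0)
      + -1 * (g 2 1 0 3 - g 2 1 3 0 + g 2 0 3 1 - g 2 0 1 3 + g 2 3 1 0 - g 2 3 0 1)
      + -1 * (g 3 1 2 0 - g 3 1 0 2 + g 3 2 0 1 - g 3 2 1 0 + g 3 0 1 2 - g 3 0 2 1) = _
  ring

theorem wedge_apply {k l m : ℕ} (h : k + l = m) (α : Form k) (β : Form l) (v : Fin m → E4) :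
    wedge α β h v = ((k.factorial : ℂ) * (l.factorial : ℂ))⁻¹ *
      ∑ σ : Equiv.Perm (Fin m), Equiv.Perm.sign σ •
        (α (fun i => v (σ (Fin.cast h (Fin.castAdd l i)))) *
          β (fun j => v (σ (Fin.cast h (Fin.natAdd k j))))) := by
  simp only [wedge, ContinuousAlternatingMap.smul_apply,
    ContinuousMultilinearMap.alternatization_apply_apply, tensorForm_apply, Function.comp]
  rw [Complex.real_smul]
  push_cast
  rfl

theorem Form.swap_two (α : Form 2) (x y : E4) : α ![y, x] = -α ![x, y] := by
  refine (congrArg α ?_).trans (α.map_swap ![x, y] (i := 0) (j := 1) (by decide))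
  funext i
  fin_cases i <;> rfl

theorem Form.swap_three_left (α : Form 3) (x y z : E4) : α ![y, x, z] = -α ![x, y, z] := by
  refine (congrArg α ?_).trans (α.map_swap ![x, y, z] (i := 0) (j := 1) (by decide))
  funext i
  fin_cases i <;> rfl

theorem Form.swap_three_right (α : Form 3) (x y z : E4) : α ![x, z, y] = -α ![x, y, z] := by
  refine (congrArg α ?_).trans (α.map_swap ![x, y, z] (i := 1) (j := 2) (by decide))
  funext i
  fin_cases i <;> rfl

theorem vec_eta_one (w : Fin 1 → E4) : w = ![w 0] := by
  funext i; fin_cases i; rfl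

theorem vec_eta_two (w : Fin 2 → E4) : w = ![w 0, w 1] := by
  funext i; fin_cases i <;> rfl

theorem vec_eta_three (w : Fin 3 → E4) : w = ![w 0, w 1, w 2] := by
  funext i; fin_cases i <;> rfl

theorem vec_eta_four (w : Fin 4 → E4) : w = ![w 0, w 1, w 2, w 3] := by
  funext i; fin_cases i <;> rfl

theorem wedge_one_zero (α : Form 1) (β : Form 0) (h : 1 + 0 = 1) (x : E4) :
    wedge α β h ![x] = α ![x] * β ![] := by
  rw [wedge_apply]
  simp only [Fintype.sum_unique]
  simp [Subsingleton.elim _ (![] : Fin 0 → E4)]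
  left
  congr 1
  funext i
  fin_cases i; rfl

theorem wedge_one_one (α β : Form 1) (h : 1 + 1 = 2) (x y : E4) :
    wedge α β h ![x, y] = α ![x] * β ![y] - α ![y] * β ![x] := by
  rw [wedge_apply]
  refine (congrArg (_ * ·) ((Finset.sum_congr rfl fun σ _ => ?_).trans
    (sum_perm_two fun a b =>
    α ![(![x, y] : Fin 2 → E4) a] * β ![(![x, y] : Fin 2 → E4) b]))).trans ?_
  · exact congrArg (Equiv.Perm.sign σ • ·)
      (congrArg₂ _ (congrArg α (vec_eta_one _)) (congrArg β (vec_eta_one _)))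
  simp

/-- The prefactor `(k! l!)⁻¹` cancels permutations inside each factor, so every shuffle survives
once. With such expansions on explicit vectors, later identities between forms become polynomial
identities for `ring` or `linear_combination`. -/
theorem wedge_one_two (α : Form 1) (β : Form 2) (h : 1 + 2 = 3) (x y z : E4) :
    wedge α β h ![x, y, z] = α ![x] * β ![y, z] - α ![y] * β ![x, z] + α ![z] * β ![x, y] := by
  rw [wedge_apply]
  refine (congrArg (_ * ·) ((Finset.sum_congr rfl fun σ _ => ?_).trans
    (sum_perm_three fun a b c =>
    α ![(![x, y, z] : Fin 3 → E4) a] *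
      β ![(![x, y, z] : Fin 3 → E4) b, (![x, y, z] : Fin 3 → E4) c]))).trans ?_
  · exact congrArg (Equiv.Perm.sign σ • ·)
      (congrArg₂ _ (congrArg α (vec_eta_one _)) (congrArg β (vec_eta_two _)))
  simp [β.swap_two x y, β.swap_two x z, β.swap_two y z]
  ring

theorem wedge_two_one (α : Form 2) (β : Form 1) (h : 2 + 1 = 3) (x y z : E4) :
    wedge α β h ![x, y, z] = α ![y, z] * β ![x] - α ![x, z] * β ![y] + α ![x, y] * β ![z] := by
  rw [wedge_apply]
  refine (congrArg (_ * ·) ((Finset.sum_congr rfl fun σ _ => ?_).trans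
    (sum_perm_three fun a b c =>
    α ![(![x, y, z] : Fin 3 → E4) a, (![x, y, z] : Fin 3 → E4) b] *
      β ![(![x, y, z] : Fin 3 → E4) c]))).trans ?_
  · exact congrArg (Equiv.Perm.sign σ • ·)
      (congrArg₂ _ (congrArg α (vec_eta_two _)) (congrArg β (vec_eta_one _)))
  simp [α.swap_two x y, α.swap_two x z, α.swap_two y z]
  ring

theorem wedge_two_two (α β : Form 2) (h : 2 + 2 = 4) (x y z w : E4) :
    wedge α β h ![x, y, z, w] = α ![x, y] * β ![z, w] - α ![x, z] * β ![y, w]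
      + α ![x, w] * β ![y, z] + α ![y, z] * β ![x, w] - α ![y, w] * β ![x, z]
      + α ![z, w] * β ![x, y] := by
  rw [wedge_apply]
  refine (congrArg (_ * ·) ((Finset.sum_congr rfl fun σ _ => ?_).trans
    (sum_perm_four fun a b c d =>
    α ![(![x, y, z, w] : Fin 4 → E4) a, (![x, y, z, w] : Fin 4 → E4) b] *
      β ![(![x, y, z, w] : Fin 4 → E4) c, (![x, y, z, w] : Fin 4 → E4) d]))).trans ?_
  · exact congrArg (Equiv.Perm.sign σ • ·)
      (congrArg₂ _ (congrArg α (vec_eta_two _)) (congrArg β (vec_eta_two _)))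
  simp [α.swap_two x y, α.swap_two x z, α.swap_two y z, α.swap_two x w, α.swap_two y w,
    α.swap_two z w, β.swap_two x y, β.swap_two x z, β.swap_two y z, β.swap_two x w,
    β.swap_two y w, β.swap_two z w]
  ring

theorem wedge_three_one (α : Form 3) (β : Form 1) (h : 3 + 1 = 4) (x y z w : E4) :
    wedge α β h ![x, y, z, w] = α ![x, y, z] * β ![w] - α ![x, y, w] * β ![z]
      + α ![x, z, w] * β ![y] - α ![y, z, w] * β ![x] := by
  rw [wedge_apply]
  refine (congrArg (_ * ·) ((Finset.sum_congr rfl fun σ _ => ?_).trans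
    (sum_perm_four fun a b c d =>
    α ![(![x, y, z, w] : Fin 4 → E4) a, (![x, y, z, w] : Fin 4 → E4) b,
      (![x, y, z, w] : Fin 4 → E4) c] * β ![(![x, y, z, w] : Fin 4 → E4) d]))).trans ?_
  · exact congrArg (Equiv.Perm.sign σ • ·)
      (congrArg₂ _ (congrArg α (vec_eta_three _)) (congrArg β (vec_eta_one _)))
  -- All orderings of three arguments are brought back to the increasing one.
  have e (a b c : E4) : α ![a, c, b] = -α ![a, b, c] ∧ α ![b, a, c] = -α ![a, b, c] ∧
      α ![b, c, a] = α ![a, b, c] ∧ α ![c, a, b] = α ![a, b, c] ∧ α ![c, b, a] = -α ![a, b, c] := by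
    refine ⟨α.swap_three_right _ _ _, α.swap_three_left _ _ _, ?_, ?_, ?_⟩
    · rw [α.swap_three_right b a c, α.swap_three_left a b c, neg_neg]
    · rw [α.swap_three_left a c b, α.swap_three_right a b c, neg_neg]
    · rw [α.swap_three_right c a b, α.swap_three_left a c b, α.swap_three_right a b c, neg_neg]
  simp [e x y z, e x y w, e x z w, e y z w, Nat.factorial]
  ring

/-- Finite dimension makes algebraically bilinear maps of forms, such as the wedge product and
contraction, automatically continuous and hence smooth. -/
instance (k : ℕ) : FiniteDimensional ℝ (Form k) :=
  Module.Finite.of_injective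
    (ContinuousMultilinearMap.toMultilinearMapLinear (R' := ℝ) (A := ℝ) ∘ₗ
      ContinuousAlternatingMap.toContinuousMultilinearMapLinear (R := ℝ) (A := ℝ) :
        Form k →ₗ[ℝ] MultilinearMap ℝ (fun _ : Fin k => E4) ℂ)
    (ContinuousMultilinearMap.toMultilinearMap_injective.comp
      ContinuousAlternatingMap.toContinuousMultilinearMap_injective)

/-! ### Exterior calculus -/

/-- All `k!` permutations contribute equally, the sign of each being squared, and the normalisation
removes the factor. -/
theorem wedge_zero_left {k : ℕ} (α : Form 0) (β : Form k) (h : 0 + k = k) :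
    wedge α β h = α ![] • β := by
  ext v
  rw [wedge_apply]
  have key (σ : Equiv.Perm (Fin k)) : Equiv.Perm.sign σ •
      (α (fun i => v (σ (Fin.cast h (Fin.castAdd k i)))) *
        β (fun j => v (σ (Fin.cast h (Fin.natAdd 0 j))))) = α ![] * β v := by
    have h1 : (fun j => v (σ (Fin.cast h (Fin.natAdd 0 j)))) = v ∘ σ := by
      funext j
      simp only [Function.comp]
      congr 2
      ext
      simp
    have h2 : β (v ∘ σ) = Equiv.Perm.sign σ • β v := β.toAlternatingMap.map_perm v σ
    rw [h1, h2, Subsingleton.elim (fun i => v (σ (Fin.cast h (Fin.castAdd k i)))) ![],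
      mul_smul_comm, smul_smul, Int.units_mul_self, one_smul]
  rw [Finset.sum_congr rfl fun σ _ => key σ]
  have hk : (k.factorial : ℂ) ≠ 0 := by exact_mod_cast k.factorial_ne_zero
  simp [Fintype.card_perm]
  field_simp

/-- The exterior product as a continuous bilinear map. -/
def wedgeCLM {k l m : ℕ} (h : k + l = m) : Form k →L[ℝ] Form l →L[ℝ] Form m :=
  LinearMap.toContinuousBilinearMap <| LinearMap.mk₂ ℝ (fun α β => wedge α β h)
      (fun α α' β => by
        ext v
        simp only [ContinuousAlternatingMap.add_apply, wedge_apply, add_mul, smul_add,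
          Finset.sum_add_distrib, mul_add])
      (fun c α β => by
        ext v
        simp only [ContinuousAlternatingMap.smul_apply, wedge_apply, smul_mul_assoc,
          smul_comm _ c, ← Finset.smul_sum, mul_smul_comm])
      (fun α β β' => by
        ext v
        simp only [ContinuousAlternatingMap.add_apply, wedge_apply, smul_add,
          Finset.sum_add_distrib, mul_add])
      (fun c α β => by
        ext v
        simp only [ContinuousAlternatingMap.smul_apply, wedge_apply,
          smul_comm _ c, ← Finset.smul_sum, mul_smul_comm])

theorem wedgeCLM_apply {k l m : ℕ} (h : k + l = m) (α : Form k) (β : Form l) :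
    wedgeCLM h α β = wedge α β h := rfl

theorem contDiffOn_wedge {k l m : ℕ} (h : k + l = m) {α : E4 → Form k} {β : E4 → Form l}
    {s : Set E4} (hα : ContDiffOn ℝ ∞ α s) (hβ : ContDiffOn ℝ ∞ β s) :
    ContDiffOn ℝ ∞ (fun x => wedge (α x) (β x) h) s := by
  simp only [← wedgeCLM_apply]
  fun_prop

theorem differentiableAt_wedge {k l m : ℕ} (h : k + l = m) {α : E4 → Form k} {β : E4 → Form l}
    {x : E4} (hα : DifferentiableAt ℝ α x) (hβ : DifferentiableAt ℝ β x) :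
    DifferentiableAt ℝ (fun y => wedge (α y) (β y) h) x := by
  simp only [← wedgeCLM_apply]
  fun_prop

theorem fderiv_wedge {k l m : ℕ} (h : k + l = m) {α : E4 → Form k} {β : E4 → Form l} {x : E4}
    (hα : DifferentiableAt ℝ α x) (hβ : DifferentiableAt ℝ β x) (v : E4) :
    fderiv ℝ (fun y => wedge (α y) (β y) h) x v =
      wedge (fderiv ℝ α x v) (β x) h + wedge (α x) (fderiv ℝ β x v) h := by
  have := congrArg (fun L => L v) ((wedgeCLM h).fderiv_of_bilinear hα hβ)
  simpa [wedgeCLM_apply, add_comm] using this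

theorem extDeriv_zero_apply (α : E4 → Form 0) (x u : E4) :
    extDeriv α x ![u] = fderiv ℝ α x u ![] := by
  rw [extDeriv, ContinuousAlternatingMap.alternatizeUncurryFin_apply]
  simp [Subsingleton.elim _ (![] : Fin 0 → E4)]

theorem extDeriv_one_apply (α : E4 → Form 1) (x u v : E4) :
    extDeriv α x ![u, v] = fderiv ℝ α x u ![v] - fderiv ℝ α x v ![u] := by
  rw [extDeriv, ContinuousAlternatingMap.alternatizeUncurryFin_apply]
  have h (i : Fin 2) (w : Fin 2 → E4) : i.removeNth w = ![w (i.succAbove 0)] := vec_eta_one _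
  rw [Fin.sum_univ_two, h, h]
  change (-1 : ℤ) ^ 0 • fderiv ℝ α x u ![v] + (-1 : ℤ) ^ 1 • fderiv ℝ α x v ![u] = _
  simp [sub_eq_add_neg]

theorem extDeriv_two_apply (α : E4 → Form 2) (x u v w : E4) :
    extDeriv α x ![u, v, w] =
      fderiv ℝ α x u ![v, w] - fderiv ℝ α x v ![u, w] + fderiv ℝ α x w ![u, v] := by
  rw [extDeriv, ContinuousAlternatingMap.alternatizeUncurryFin_apply]
  have h (i : Fin 3) (w : Fin 3 → E4) :
    i.removeNth w = ![w (i.succAbove 0), w (i.succAbove 1)] := vec_eta_two _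
  rw [Fin.sum_univ_three, h, h, h]
  change (-1 : ℤ) ^ 0 • fderiv ℝ α x u ![v, w] + (-1 : ℤ) ^ 1 • fderiv ℝ α x v ![u, w]
    + (-1 : ℤ) ^ 2 • fderiv ℝ α x w ![u, v] = _
  simp [sub_eq_add_neg]

theorem extDeriv_three_apply (α : E4 → Form 3) (x u v w y : E4) :
    extDeriv α x ![u, v, w, y] = fderiv ℝ α x u ![v, w, y] - fderiv ℝ α x v ![u, w, y]
      + fderiv ℝ α x w ![u, v, y] - fderiv ℝ α x y ![u, v, w] := by
  rw [extDeriv, ContinuousAlternatingMap.alternatizeUncurryFin_apply]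
  have h (i : Fin 4) (w : Fin 4 → E4) : i.removeNth w =
    ![w (i.succAbove 0), w (i.succAbove 1), w (i.succAbove 2)] := vec_eta_three _
  rw [Fin.sum_univ_four, h, h, h, h]
  change (-1 : ℤ) ^ 0 • fderiv ℝ α x u ![v, w, y] + (-1 : ℤ) ^ 1 • fderiv ℝ α x v ![u, w, y]
    + (-1 : ℤ) ^ 2 • fderiv ℝ α x w ![u, v, y] + (-1 : ℤ) ^ 3 • fderiv ℝ α x y ![u, v, w] = _
  simp [sub_eq_add_neg, pow_succ]

theorem extDeriv_wedge_one_one {α β : E4 → Form 1} {x : E4}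
    (hα : DifferentiableAt ℝ α x) (hβ : DifferentiableAt ℝ β x) :
    extDeriv (fun y => (wedge (α y) (β y) : Form 2)) x =
      (wedge (extDeriv α x) (β x) : Form 3) - wedge (α x) (extDeriv β x) := by
  ext v
  rw [vec_eta_three v, ContinuousAlternatingMap.sub_apply, wedge_one_two, wedge_two_one]
  simp only [extDeriv_two_apply, extDeriv_one_apply, fderiv_wedge _ hα hβ,
    ContinuousAlternatingMap.add_apply, wedge_one_one]
  ring

theorem extDeriv_wedge_two_one {α : E4 → Form 2} {β : E4 → Form 1} {x : E4}
    (hα : DifferentiableAt ℝ α x) (hβ : DifferentiableAt ℝ β x) :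
    extDeriv (fun y => (wedge (α y) (β y) : Form 3)) x =
      (wedge (extDeriv α x) (β x) : Form 4) + wedge (α x) (extDeriv β x) := by
  ext v
  rw [vec_eta_four v, ContinuousAlternatingMap.add_apply, wedge_three_one, wedge_two_two]
  simp only [extDeriv_three_apply, extDeriv_two_apply, extDeriv_one_apply, fderiv_wedge _ hα hβ,
    ContinuousAlternatingMap.add_apply, wedge_two_one]
  ring

theorem extDeriv_wedge_zero_two {α : E4 → Form 0} {β : E4 → Form 2} {x : E4}
    (hα : DifferentiableAt ℝ α x) (hβ : DifferentiableAt ℝ β x) :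
    extDeriv (fun y => (wedge (α y) (β y) : Form 2)) x =
      (wedge (extDeriv α x) (β x) : Form 3) + wedge (α x) (extDeriv β x) := by
  ext v
  rw [vec_eta_three v, ContinuousAlternatingMap.add_apply, wedge_one_two]
  simp only [wedge_zero_left, ContinuousAlternatingMap.smul_apply, extDeriv_two_apply,
    extDeriv_zero_apply, smul_eq_mul]
  have h (v : E4) : fderiv ℝ (fun y => α y ![] • β y) x v =
      fderiv ℝ α x v ![] • β x + α x ![] • fderiv ℝ β x v := by
    simpa only [wedge_zero_left] using fderiv_wedge (zero_add 2) hα hβ v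
  simp only [h, ContinuousAlternatingMap.add_apply, ContinuousAlternatingMap.smul_apply,
    smul_eq_mul]
  ring

theorem differentiableAt_of_contDiffOn {F : Type*} [NormedAddCommGroup F] [NormedSpace ℝ F]
    {α : E4 → F} {s : Set E4} (hs : IsOpen s) (hα : ContDiffOn ℝ ∞ α s) {x : E4} (hx : x ∈ s) :
    DifferentiableAt ℝ α x :=
  (hα.contDiffAt (hs.mem_nhds hx)).differentiableAt (by simp)

theorem contDiffOn_extDeriv {k : ℕ} {α : E4 → Form k} {s : Set E4} (hs : IsOpen s)
    (hα : ContDiffOn ℝ ∞ α s) : ContDiffOn ℝ ∞ (extDeriv α) s :=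
  (ContinuousAlternatingMap.alternatizeUncurryFinCLM ℝ E4 ℂ).contDiff.comp_contDiffOn
    (hα.fderiv_of_isOpen hs (by simp))

theorem extDeriv_sum {ι : Type*} (s : Finset ι) {k : ℕ} {α : ι → E4 → Form k} {x : E4}
    (hα : ∀ i ∈ s, DifferentiableAt ℝ (α i) x) :
    extDeriv (fun y => ∑ i ∈ s, α i y) x = ∑ i ∈ s, extDeriv (α i) x := by
  classical
  have h : ∀ f : E4 → Form k, extDeriv f x =
    ContinuousAlternatingMap.alternatizeUncurryFinCLM ℝ E4 ℂ (fderiv ℝ f x) := fun f => rfl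
  simp only [h, fderiv_fun_sum hα, map_sum]

theorem extDeriv_const_smul_complex {k : ℕ} {α : E4 → Form k} {x : E4} (c : ℂ)
    (hα : DifferentiableAt ℝ α x) :
    extDeriv (fun y => c • α y) x = c • extDeriv α x := by
  ext v
  rw [extDeriv, ContinuousAlternatingMap.alternatizeUncurryFin_apply,
    ContinuousAlternatingMap.smul_apply, extDeriv,
    ContinuousAlternatingMap.alternatizeUncurryFin_apply, fderiv_fun_const_smul hα]
  simp [mul_left_comm, Finset.mul_sum]

theorem isOpen_shell (s t : ℝ) : IsOpen (shell s t) :=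
  (isOpen_lt continuous_const continuous_norm).inter (isOpen_lt continuous_norm continuous_const)

theorem isOpen_spacetime : IsOpen spacetime := isOpen_shell 1 2

/-! ### Spinor algebra -/

/-- The primed variants differ only in the form of the degree, such as `1 + 1` for `2`, in which
covariant derivatives produce it; `simp` can then match it syntactically. -/
theorem wedge_one_one' (α β : Form 1) (h : 1 + 1 = 1 + 1) (x y : E4) :
    wedge α β h ![x, y] = α ![x] * β ![y] - α ![y] * β ![x] := wedge_one_one α β h x y

theorem wedge_one_two' (α : Form 1) (β : Form 2) (h : 1 + 2 = 2 + 1) (x y z : E4) :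
    wedge α β h ![x, y, z] = α ![x] * β ![y, z] - α ![y] * β ![x, z] + α ![z] * β ![x, y] :=
  wedge_one_two α β h x y z

theorem wedge_one_zero' (α : Form 1) (β : Form 0) (h : 1 + 0 = 0 + 1) (x : E4) :
    wedge α β h ![x] = α ![x] * β ![] := wedge_one_zero α β h x

theorem mixed_zero {k : ℕ} (α : SpinForm k) (B : Fin 2) (x : E4) : mixed α 0 B x = α 1 B x := by
  ext v
  simp [mixed, eps]

theorem mixed_one {k : ℕ} (α : SpinForm k) (B : Fin 2) (x : E4) : mixed α 1 B x = -α 0 B x := by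
  ext v
  simp [mixed, eps]

theorem raise_zero_zero {k : ℕ} (α : SpinForm k) (x : E4) : raise α 0 0 x = α 1 1 x := by
  ext v
  simp [raise, eps]

theorem raise_zero_one {k : ℕ} (α : SpinForm k) (x : E4) : raise α 0 1 x = -α 1 0 x := by
  ext v
  simp [raise, eps]

theorem raise_one_zero {k : ℕ} (α : SpinForm k) (x : E4) : raise α 1 0 x = -α 0 1 x := by
  ext v
  simp [raise, eps]

theorem raise_one_one {k : ℕ} (α : SpinForm k) (x : E4) : raise α 1 1 x = α 0 0 x := by
  ext v
  simp [raise, eps]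

theorem lower_eq_raise {k : ℕ} (α : SpinForm k) : lower α = raise α := by
  funext A B x
  simp only [lower, raise]
  fin_cases A <;> fin_cases B <;> simp [eps]

theorem differentiableAt_of_symmSmooth {k : ℕ} {α : SpinForm k} (hα : IsSymmSmooth α) {x : E4}
    (hx : x ∈ spacetime) (A B : Fin 2) : DifferentiableAt ℝ (α A B) x :=
  differentiableAt_of_contDiffOn isOpen_spacetime (hα.2 A B) hx

theorem isSymmSmooth_raise {k : ℕ} {α : SpinForm k} (hα : IsSymmSmooth α) :
    IsSymmSmooth (raise α) := by
  constructor
  · intro A B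
    funext x
    fin_cases A <;> fin_cases B <;>
      simp [raise_zero_one, raise_one_zero, hα.1 1 0]
  · intro A B
    exact ContDiffOn.sum fun C _ => ContDiffOn.sum fun D _ => (hα.2 C D).const_smul _

theorem isSymmSmooth_covDerivDown {k : ℕ} {Γ : SpinForm 1} {α : SpinForm k} (hΓ : IsSymmSmooth Γ)
    (hα : IsSymmSmooth α) : IsSymmSmooth (covDerivDown Γ α) := by
  constructor
  · intro A B
    funext x
    simp only [covDerivDown, hα.1 A B, fun C => hα.1 A C, fun C => hα.1 C B, add_comm]
  · intro A B
    have hm (C D : Fin 2) : ContDiffOn ℝ ∞ (mixed Γ C D) spacetime :=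
      ContDiffOn.sum fun E _ => (hΓ.2 E D).const_smul _
    exact (contDiffOn_extDeriv isOpen_spacetime (hα.2 A B)).sub <| ContDiffOn.sum fun C _ =>
      (contDiffOn_wedge _ (hm C A) (hα.2 C B)).add (contDiffOn_wedge _ (hm C B) (hα.2 A C))

theorem contDiffOn_pair {k l m : ℕ} {α : SpinForm k} {β : SpinForm l} (h : k + l = m)
    (hα : IsSymmSmooth α) (hβ : IsSymmSmooth β) : ContDiffOn ℝ ∞ (pair α β h) spacetime :=
  ContDiffOn.sum fun A _ => ContDiffOn.sum fun B _ => contDiffOn_wedge h (hα.2 A B) (hβ.2 A B)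

theorem extDeriv_pair {k l m : ℕ} {α : SpinForm k} {β : SpinForm l} {x : E4} (h : k + l = m)
    (hα : ∀ A B, DifferentiableAt ℝ (α A B) x) (hβ : ∀ A B, DifferentiableAt ℝ (β A B) x) :
    extDeriv (pair α β h) x =
      ∑ A, ∑ B, extDeriv (fun y => wedge (α A B y) (β A B y) h) x := by
  unfold pair
  rw [extDeriv_sum _ fun A _ => DifferentiableAt.fun_sum fun B _ =>
    differentiableAt_wedge h (hα A B) (hβ A B)]
  refine Finset.sum_congr rfl fun A _ => ?_
  rw [extDeriv_sum _ fun B _ => differentiableAt_wedge h (hα A B) (hβ A B)]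

theorem extDeriv_raise {k : ℕ} {α : SpinForm k} {x : E4}
    (hα : ∀ A B, DifferentiableAt ℝ (α A B) x) (A B : Fin 2) :
    extDeriv (raise α A B) x = raise (fun C D => extDeriv (α C D)) A B x := by
  unfold raise
  rw [extDeriv_sum _ fun C _ => DifferentiableAt.fun_sum fun D _ => (hα C D).fun_const_smul _]
  refine Finset.sum_congr rfl fun C _ => ?_
  rw [extDeriv_sum _ fun D _ => (hα C D).fun_const_smul _]
  exact Finset.sum_congr rfl fun D _ => extDeriv_const_smul_complex _ (hα C D)

theorem differentiableAt_raise {k : ℕ} {α : SpinForm k} {x : E4}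
    (hα : ∀ A B, DifferentiableAt ℝ (α A B) x) (A B : Fin 2) :
    DifferentiableAt ℝ (raise α A B) x :=
  DifferentiableAt.fun_sum fun C _ => DifferentiableAt.fun_sum fun D _ =>
    (hα C D).fun_const_smul _

/-- A full contraction of spinor indices is invariant under frame rotations, so the connection terms
of the upper and lower covariant derivatives cancel. -/
theorem covariant_leibniz_two_one {Γ : SpinForm 1} {α : SpinForm 2} {β : SpinForm 1} {x : E4}
    (hΓ : ∀ A B, Γ A B = Γ B A) (hα : ∀ A B, α A B = α B A) (hβ : ∀ A B, β A B = β B A)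
    (hα' : ∀ A B, DifferentiableAt ℝ (α A B) x) (hβ' : ∀ A B, DifferentiableAt ℝ (β A B) x) :
    extDeriv (pair α β (m := 3) (by omega)) x =
      ∑ A, ∑ B, ((wedge (covDerivUp Γ α A B x) (β A B x) : Form 4) +
        wedge (α A B x) (covDerivDown Γ β A B x)) := by
  rw [extDeriv_pair _ hα' hβ']
  simp only [extDeriv_wedge_two_one (hα' _ _) (hβ' _ _)]
  ext v
  rw [vec_eta_four v]
  simp only [Fin.sum_univ_two, covDerivUp, covDerivDown, spinAct, mixed_zero, mixed_one,
    hΓ 1 0, hα 1 0, hβ 1 0,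
    ContinuousAlternatingMap.add_apply, ContinuousAlternatingMap.sub_apply,
    ContinuousAlternatingMap.neg_apply,
    wedge_three_one, wedge_two_two, wedge_one_two', wedge_one_one']
  ring

theorem covariant_leibniz_one_one {Γ : SpinForm 1} {α β : SpinForm 1} {x : E4}
    (hΓ : ∀ A B, Γ A B = Γ B A) (hα : ∀ A B, α A B = α B A) (hβ : ∀ A B, β A B = β B A)
    (hα' : ∀ A B, DifferentiableAt ℝ (α A B) x) (hβ' : ∀ A B, DifferentiableAt ℝ (β A B) x) :
    extDeriv (pair (raise α) β (m := 2) (by omega)) x =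
      ∑ A, ∑ B, ((wedge (raise (covDerivDown Γ α) A B x) (β A B x) : Form 3) -
        wedge (raise α A B x) (covDerivDown Γ β A B x)) := by
  rw [extDeriv_pair _ (differentiableAt_raise hα') hβ']
  simp only [extDeriv_wedge_one_one (differentiableAt_raise hα' _ _) (hβ' _ _),
    extDeriv_raise hα']
  ext v
  rw [vec_eta_three v]
  simp only [Fin.sum_univ_two, raise_zero_zero, raise_zero_one, raise_one_zero, raise_one_one,
    covDerivDown, mixed_zero, mixed_one, hΓ 1 0, hα 1 0, hβ 1 0,
    ContinuousAlternatingMap.add_apply, ContinuousAlternatingMap.sub_apply,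
    ContinuousAlternatingMap.neg_apply,
    wedge_two_one, wedge_one_two, wedge_one_one']
  ring

theorem covariant_leibniz_zero_two {Γ : SpinForm 1} {α : SpinForm 0} {β : SpinForm 2} {x : E4}
    (hΓ : ∀ A B, Γ A B = Γ B A) (hα : ∀ A B, α A B = α B A) (hβ : ∀ A B, β A B = β B A)
    (hα' : ∀ A B, DifferentiableAt ℝ (α A B) x) (hβ' : ∀ A B, DifferentiableAt ℝ (β A B) x) :
    extDeriv (pair (raise α) β (m := 2) (by omega)) x =
      ∑ A, ∑ B, ((wedge (raise (k := 1) (covDerivDown Γ α) A B x) (β A B x) : Form 3) +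
        wedge (raise α A B x) (covDerivDown Γ β A B x)) := by
  rw [extDeriv_pair _ (differentiableAt_raise hα') hβ']
  simp only [extDeriv_wedge_zero_two (differentiableAt_raise hα' _ _) (hβ' _ _),
    extDeriv_raise hα']
  ext v
  rw [vec_eta_three v]
  simp only [Fin.sum_univ_two, raise_zero_zero, raise_zero_one, raise_one_zero, raise_one_one,
    covDerivDown, mixed_zero, mixed_one, hΓ 1 0, hα 1 0, hβ 1 0,
    ContinuousAlternatingMap.add_apply, ContinuousAlternatingMap.sub_apply,
    ContinuousAlternatingMap.neg_apply, ContinuousAlternatingMap.smul_apply, smul_eq_mul,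
    wedge_zero_left, wedge_one_two', wedge_one_zero']
  ring

theorem extDeriv_mixed {k : ℕ} {α : SpinForm k} {x : E4}
    (hα : ∀ A B, DifferentiableAt ℝ (α A B) x) (A B : Fin 2) :
    extDeriv (mixed α A B) x = mixed (fun C D => extDeriv (α C D)) A B x := by
  unfold mixed
  rw [extDeriv_sum _ fun C _ => (hα C B).fun_const_smul _]
  exact Finset.sum_congr rfl fun C _ => extDeriv_const_smul_complex _ (hα C B)

/-- With d² = 0 only first derivatives of Γ and α remain, and these can be replaced through the
field equations. This is the input to the linearised Bianchi identity. -/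
theorem extDeriv_covDerivDown {Γ α : SpinForm 1} {x : E4} (hΓ : IsSymmSmooth Γ)
    (hα : IsSymmSmooth α) (hx : x ∈ spacetime) (A B : Fin 2) :
    extDeriv (covDerivDown Γ α A B) x =
      -∑ C, (((wedge (mixed (fun E F => extDeriv (Γ E F)) C A x) (α C B x) : Form 3) -
          wedge (mixed Γ C A x) (extDeriv (α C B) x)) +
        ((wedge (mixed (fun E F => extDeriv (Γ E F)) C B x) (α A C x) : Form 3) -
          wedge (mixed Γ C B x) (extDeriv (α A C) x))) := by
  have dΓ := differentiableAt_of_symmSmooth hΓ hx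
  have dα := differentiableAt_of_symmSmooth hα hx
  have dm (C D : Fin 2) : DifferentiableAt ℝ (mixed Γ C D) x :=
    DifferentiableAt.fun_sum fun E _ => (dΓ E D).fun_const_smul _
  have hd : DifferentiableAt ℝ (extDeriv (α A B)) x :=
    differentiableAt_of_contDiffOn isOpen_spacetime
      (contDiffOn_extDeriv isOpen_spacetime (hα.2 A B)) hx
  have hdd : extDeriv (extDeriv (α A B)) x = 0 :=
    extDeriv_extDeriv_apply ((hα.2 A B).contDiffAt (isOpen_spacetime.mem_nhds hx)) (by
      rw [minSmoothness_of_isRCLikeNormedField]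
      exact ENat.LEInfty.out)
  have h1 (C D E F : Fin 2) : DifferentiableAt ℝ
      (fun y => (wedge (mixed Γ C D y) (α E F y) : Form 2)) x :=
    differentiableAt_wedge _ (dm C D) (dα E F)
  have hs : DifferentiableAt ℝ (fun y => ∑ C, ((wedge (mixed Γ C A y) (α C B y) : Form 2) +
      wedge (mixed Γ C B y) (α A C y))) x :=
    DifferentiableAt.fun_sum fun C _ => (h1 _ _ _ _).fun_add (h1 _ _ _ _)
  have hsub {f g : E4 → Form 2} (hf : DifferentiableAt ℝ f x) (hg : DifferentiableAt ℝ g x) :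
      extDeriv (fun y => f y - g y) x = extDeriv f x - extDeriv g x := by
    have h : ∀ f : E4 → Form 2, extDeriv f x =
      ContinuousAlternatingMap.alternatizeUncurryFinCLM ℝ E4 ℂ (fderiv ℝ f x) := fun f => rfl
    rw [h, h, h, fderiv_fun_sub hf hg, map_sub]
  refine (hsub hd hs).trans ?_
  rw [hdd, zero_sub, extDeriv_sum _ fun C _ => (h1 _ _ _ _).fun_add (h1 _ _ _ _)]
  refine congrArg _ (Finset.sum_congr rfl fun C _ => ?_)
  rw [extDeriv_fun_add (h1 _ _ _ _) (h1 _ _ _ _), extDeriv_wedge_one_one (dm _ _) (dα _ _),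
    extDeriv_wedge_one_one (dm _ _) (dα _ _), extDeriv_mixed dΓ, extDeriv_mixed dΓ]

/-! ### Totally symmetric spinors -/

/-- Relabelling the indices by π moves π from ψ onto `W`. Averaging over π therefore leaves only the
symmetrisation of `W`, which is zero. -/
theorem sum_mul_eq_zero_of_symm {κ : Type*} [Fintype κ] {n : ℕ} (ψ W : (Fin n → κ) → ℂ)
    (hψ : ∀ (π : Equiv.Perm (Fin n)) I, ψ (I ∘ π) = ψ I)
    (hW : ∀ I, ∑ π : Equiv.Perm (Fin n), W (I ∘ π) = 0) : ∑ I, ψ I * W I = 0 := by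
  have h1 (π : Equiv.Perm (Fin n)) : ∑ I, ψ I * W I = ∑ I, ψ I * W (I ∘ π) := by
    rw [← Equiv.sum_comp (Equiv.arrowCongr π.symm (Equiv.refl κ)) fun I => ψ I * W I]
    refine Finset.sum_congr rfl fun I _ => ?_
    have : (Equiv.arrowCongr π.symm (Equiv.refl κ)) I = I ∘ π := rfl
    rw [this, hψ]
  have h2 : ∑ _π : Equiv.Perm (Fin n), ∑ I, ψ I * W I = 0 := by
    rw [Finset.sum_congr rfl fun π _ => h1 π, Finset.sum_comm]
    simp only [← Finset.mul_sum, hW, mul_zero, Finset.sum_const_zero]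
  have h3 : ((n.factorial : ℕ) : ℂ) ≠ 0 := by exact_mod_cast n.factorial_ne_zero
  simpa [Fintype.card_perm, h3, Nat.factorial_ne_zero] using h2

theorem sum_fin_four {κ : Type*} [Fintype κ] (F : κ → κ → κ → κ → ℂ) :
    ∑ I : Fin 4 → κ, F (I 0) (I 1) (I 2) (I 3) = ∑ A, ∑ B, ∑ C, ∑ D, F A B C D := by
  have h (n : ℕ) (G : (Fin (n + 1) → κ) → ℂ) :
      ∑ I, G I = ∑ A, ∑ J : Fin n → κ, G (Fin.cons A J) := by
    rw [← Fintype.sum_prod_type', ← (Fin.consEquiv fun _ : Fin (n + 1) => κ).sum_comp]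
    rfl
  rw [h]
  refine Finset.sum_congr rfl fun A _ => ?_
  rw [h]
  refine Finset.sum_congr rfl fun B _ => ?_
  rw [h]
  refine Finset.sum_congr rfl fun C _ => ?_
  rw [h]
  refine Finset.sum_congr rfl fun D _ => ?_
  rw [Fintype.sum_unique]
  rfl

/-- The three symmetries in `IsWeyl` are the adjacent transpositions, and these generate S₄. -/
theorem IsWeyl.perm {ψ : WeylSpinor} (hψ : IsWeyl ψ) (x : E4) (π : Equiv.Perm (Fin 4))
    (I : Fin 4 → Fin 2) :
    ψ ((I ∘ π) 0) ((I ∘ π) 1) ((I ∘ π) 2) ((I ∘ π) 3) x = ψ (I 0) (I 1) (I 2) (I 3) x := by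
  have hπ : π ∈ Submonoid.closure
      (Set.range fun i : Fin 3 => Equiv.swap i.castSucc i.succ) := by
    rw [Equiv.Perm.mclosure_swap_castSucc_succ]
    trivial
  induction hπ using Submonoid.closure_induction generalizing I with
  | mem π hπ =>
    obtain ⟨i, rfl⟩ := hπ
    fin_cases i
    · exact congrFun (hψ.1 (I 0) (I 1) (I 2) (I 3)).1.symm x
    · exact congrFun (hψ.1 (I 0) (I 1) (I 2) (I 3)).2.1.symm x
    · exact congrFun (hψ.1 (I 0) (I 1) (I 2) (I 3)).2.2.symm x
  | one => rfl
  | mul π ρ _ _ hπ hρ => exact (hρ (I ∘ π)).trans (hπ I)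

theorem wedge_smul_right {k l m : ℕ} (h : k + l = m) (α : Form k) (c : ℂ) (β : Form l) :
    wedge α (c • β) h = c • wedge α β h := by
  ext v
  simp only [wedge_apply, ContinuousAlternatingMap.smul_apply, smul_eq_mul, Finset.mul_sum]
  refine Finset.sum_congr rfl fun σ _ => ?_
  rw [mul_smul_comm, mul_smul_comm, mul_smul_comm]
  congr 1
  ring

theorem wedge_sum_right {ι : Type*} (s : Finset ι) {k l m : ℕ} (h : k + l = m) (α : Form k)
    (β : ι → Form l) : wedge α (∑ i ∈ s, β i) h = ∑ i ∈ s, wedge α (β i) h := by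
  simp only [← wedgeCLM_apply, map_sum]

/-- A totally symmetric ψ sees only the symmetrised product of α and β. This is why no Weyl spinor
appears in the bulk form. -/
theorem pair_weylAct_eq_zero {ψ : WeylSpinor} (hψ : IsWeyl ψ) {α β : SpinForm 2}
    (h : SymWedgeZero α β) {x : E4} (hx : x ∈ spacetime) :
    ∑ A, ∑ B, (wedge (α A B x) (weylAct ψ β A B x) : Form 4) = 0 := by
  ext v
  have h1 := sum_mul_eq_zero_of_symm (fun I : Fin 4 → Fin 2 => ψ (I 0) (I 1) (I 2) (I 3) x)
    (fun I => (wedge (α (I 0) (I 1) x) (β (I 2) (I 3) x) : Form 4) v) (hψ.perm x) fun I => by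
      have := congrArg (fun η : Form 4 => η v) (h x hx I)
      simpa using this
  rw [sum_fin_four fun A B C D => ψ A B C D x * (wedge (α A B x) (β C D x) : Form 4) v] at h1
  simp only [weylAct, wedge_sum_right, wedge_smul_right]
  simpa using h1

theorem contract_weylAct_eq_zero {ψ : WeylSpinor} (hψ : IsWeyl ψ) {α : SpinForm 2}
    (hα : ∀ A B, α A B = α B A) (h : SymWedgeZero α α) {x : E4} (hx : x ∈ spacetime) (X Y : E4) :
    ∑ A, ∑ B, (wedge (contract X Y (α A B x)) (weylAct ψ α A B x) : Form 3) = 0 := by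
  ext v
  rw [vec_eta_three v]
  have h0 := pair_weylAct_eq_zero hψ h hx
  have e (Z : E4) := congrArg (fun η : Form 4 => η ![Z, v 0, v 1, v 2]) h0
  have eX := e X
  have eY := e Y
  have p (A B C D : Fin 2) := hψ.1 A B C D
  have hc (A B : Fin 2) (u : E4) : contract X Y (α A B x) ![u] =
    α A B x ![X, u] + Complex.I * α A B x ![Y, u] := rfl
  have q0 : ψ 0 0 1 0 = ψ 0 0 0 1 := (p 0 0 1 0).2.2
  have q1 : ψ 0 1 0 0 = ψ 0 0 0 1 := (p 0 1 0 0).2.1.trans q0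
  have q2 : ψ 1 0 0 0 = ψ 0 0 0 1 := (p 1 0 0 0).1.trans q1
  have r0 : ψ 0 1 0 1 = ψ 0 0 1 1 := (p 0 1 0 1).2.1
  have r1 : ψ 0 1 1 0 = ψ 0 0 1 1 := (p 0 1 1 0).2.2.trans r0
  have r2 : ψ 1 0 0 1 = ψ 0 0 1 1 := (p 1 0 0 1).1.trans r0
  have r3 : ψ 1 0 1 0 = ψ 0 0 1 1 := (p 1 0 1 0).1.trans r1
  have r4 : ψ 1 1 0 0 = ψ 0 0 1 1 := (p 1 1 0 0).2.1.trans r3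
  have s0 : ψ 1 0 1 1 = ψ 0 1 1 1 := (p 1 0 1 1).1
  have s1 : ψ 1 1 0 1 = ψ 0 1 1 1 := (p 1 1 0 1).2.1.trans s0
  have s2 : ψ 1 1 1 0 = ψ 0 1 1 1 := (p 1 1 1 0).2.2.trans s1
  simp only [Fin.sum_univ_two, weylAct, hα 1 0, q0, q1, q2, r0, r1, r2, r3, r4, s0, s1, s2,
    ContinuousAlternatingMap.add_apply, ContinuousAlternatingMap.smul_apply, smul_eq_mul,
    ContinuousAlternatingMap.coe_zero, Pi.zero_apply, wedge_two_two, wedge_one_two, hc] at eX eY ⊢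
  -- Contracting ψ_{ABCD} α^{AB} ∧ α^{CD} = 0 with a vector gives two terms, equal by the symmetry
  -- of ψ and the commutation of 2-forms; hence the halves, with the factor `I` for the imaginary
  -- part of the vector field.
  linear_combination (1 / 2 : ℂ) * eX + (Complex.I / 2) * eY

/-! ### Identities for linearised solutions -/

/-- The torsion equation of `h` supplies the cubic term, and the curvature equation of `k` supplies
the Λ term. The Weyl term of `k` is cancelled by the algebraic constraint on `h`. -/
theorem extDeriv_pair_sig_gam {Λ : ℝ} {b : Background} (hb : b.IsSelfDual Λ) {h k : State}
    (hh : h.IsSolution Λ b) (hk : k.IsSolution Λ b) {x : E4} (hx : x ∈ spacetime) :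
    extDeriv (pair h.sig k.gam (m := 3) (by omega)) x =
      -((2 : ℂ) • cubic b.Sig h.gam k.gam x -
        ((Λ / 3 : ℝ) : ℂ) • pair h.sig (lower k.sig) (m := 4) (by omega) x) := by
  have hT := hh.torsion x hx
  have hC := hk.curv x hx
  have sS := hb.sig_symm_smooth.1 1 0
  have sσ := hh.sig_symm_smooth.1 1 0
  have sσ' := hk.sig_symm_smooth.1 1 0
  have sγ := hh.gam_symm_smooth.1 1 0
  have sγ' := hk.gam_symm_smooth.1 1 0
  rw [covariant_leibniz_two_one hb.gam_symm_smooth.1 hh.sig_symm_smooth.1 hk.gam_symm_smooth.1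
    (differentiableAt_of_symmSmooth hh.sig_symm_smooth hx)
    (differentiableAt_of_symmSmooth hk.gam_symm_smooth hx)]
  have hW := pair_weylAct_eq_zero hk.psi_weyl hh.tetrad hx
  ext v
  rw [vec_eta_four v]
  have e := congrArg (fun η : Form 4 => η ![v 0, v 1, v 2, v 3]) hW
  simp only [Fin.sum_univ_two, sS, sσ, sσ', sγ, sγ', hT, hC, cubic, pair, spinAct, lower_eq_raise,
    raise_zero_zero, raise_zero_one, raise_one_zero, raise_one_one, mixed_zero, mixed_one,
    ContinuousAlternatingMap.add_apply, ContinuousAlternatingMap.sub_apply,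
    ContinuousAlternatingMap.smul_apply, ContinuousAlternatingMap.neg_apply, smul_eq_mul,
    ContinuousAlternatingMap.coe_zero, Pi.zero_apply,
    wedge_three_one, wedge_two_two, wedge_one_two, wedge_one_one] at e ⊢
  linear_combination e

/-- The symplectic current of two solutions is exact up to the Weyl terms. -/
theorem pair_sub_pair {Λ : ℝ} {b : Background} (hb : b.IsSelfDual Λ) {h k : State}
    (hh : h.IsSolution Λ b) (hk : k.IsSolution Λ b) {x : E4} (hx : x ∈ spacetime) :
    ((Λ / 3 : ℝ) : ℂ) • (pair h.sig k.gam (m := 3) (by omega) x -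
        pair k.sig h.gam (m := 3) (by omega) x) =
      extDeriv (pair (raise h.gam) k.gam (m := 2) (by omega)) x
      + pair (raise h.gam) (weylAct k.psi b.Sig) (m := 3) (by omega) x
      - pair (raise k.gam) (weylAct h.psi b.Sig) (m := 3) (by omega) x := by
  have hC := hh.curv x hx
  have hC' := hk.curv x hx
  have sσ := hh.sig_symm_smooth.1 1 0
  have sσ' := hk.sig_symm_smooth.1 1 0
  have sγ := hh.gam_symm_smooth.1 1 0
  have sγ' := hk.gam_symm_smooth.1 1 0
  have sw : weylAct h.psi b.Sig 1 0 x = weylAct h.psi b.Sig 0 1 x := by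
    simp only [weylAct, (hh.psi_weyl.1 1 0 _ _).1]
  have sw' : weylAct k.psi b.Sig 1 0 x = weylAct k.psi b.Sig 0 1 x := by
    simp only [weylAct, (hk.psi_weyl.1 1 0 _ _).1]
  rw [covariant_leibniz_one_one hb.gam_symm_smooth.1 hh.gam_symm_smooth.1 hk.gam_symm_smooth.1
    (differentiableAt_of_symmSmooth hh.gam_symm_smooth hx)
    (differentiableAt_of_symmSmooth hk.gam_symm_smooth hx)]
  ext v
  rw [vec_eta_three v]
  simp only [Fin.sum_univ_two, sσ, sσ', sγ, sγ', sw, sw', hC, hC', pair, lower_eq_raise,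
    raise_zero_zero, raise_zero_one, raise_one_zero, raise_one_one,
    ContinuousAlternatingMap.add_apply, ContinuousAlternatingMap.sub_apply,
    ContinuousAlternatingMap.smul_apply, ContinuousAlternatingMap.neg_apply, smul_eq_mul,
    wedge_two_one, wedge_one_two]
  ring

/-- This is the linearised Bianchi identity. Apply D₀ to the curvature equation: D₀²γ is the action
of F₀ = (Λ/3) Σ₀ on γ, and the torsion equation makes (Λ/3) D₀σ equal to it. -/
theorem covDerivDown_weylAct {Λ : ℝ} {b : Background} (hb : b.IsSelfDual Λ) {h : State}
    (hh : h.IsSolution Λ b) {x : E4} (hx : x ∈ spacetime) (A B : Fin 2) :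
    covDerivDown b.Gam (weylAct h.psi b.Sig) A B x = 0 := by
  set c : ℂ := ((Λ / 3 : ℝ) : ℂ)
  have sS := hb.sig_symm_smooth.1 1 0
  have sG := hb.gam_symm_smooth.1 1 0
  have sσ := hh.sig_symm_smooth.1 1 0
  have sγ := hh.gam_symm_smooth.1 1 0
  have sw : weylAct h.psi b.Sig 1 0 x = weylAct h.psi b.Sig 0 1 x := by
    simp only [weylAct, (hh.psi_weyl.1 1 0 _ _).1]
  have dσ := differentiableAt_of_symmSmooth hh.sig_symm_smooth hx
  have dD := differentiableAt_of_symmSmooth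
    (isSymmSmooth_covDerivDown hb.gam_symm_smooth hh.gam_symm_smooth) hx
  -- The curvature equation holds near `x`, so ψΣ₀ can be solved for before differentiating, and no
  -- derivative of ψ occurs.
  have hw (A B : Fin 2) : extDeriv (weylAct h.psi b.Sig A B) x =
      extDeriv (covDerivDown b.Gam h.gam A B) x +
        (-c) • raise (fun C D => extDeriv (h.sig C D)) A B x := by
    rw [← extDeriv_raise dσ, ← extDeriv_const_smul_complex _ (differentiableAt_raise dσ A B),
      ← extDeriv_fun_add (dD A B) ((differentiableAt_raise dσ A B).fun_const_smul _)]
    refine Filter.EventuallyEq.extDeriv_eq ?_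
    filter_upwards [isOpen_spacetime.mem_nhds hx] with y hy
    rw [hh.curv y hy, ← lower_eq_raise, neg_smul, add_neg_cancel_right]
  have hG (A B : Fin 2) : extDeriv (b.Gam A B) x =
      c • raise b.Sig A B x - ∑ C, wedge (b.Gam A C x) (mixed b.Gam C B x) := by
    rw [← lower_eq_raise, ← hb.curv x hx A B, curvature, add_sub_cancel_right]
  have hσ (A B : Fin 2) : extDeriv (h.sig A B) x =
      -spinAct h.gam b.Sig (m := 3) (by omega) A B x
        - spinAct b.Gam h.sig (m := 3) (by omega) A B x := by
    rw [← hh.torsion x hx A B, covDerivUp, add_sub_cancel_right]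
  have hγ (A B : Fin 2) : extDeriv (h.gam A B) x =
      weylAct h.psi b.Sig A B x + c • raise h.sig A B x +
        ∑ C, (wedge (mixed b.Gam C A x) (h.gam C B x) +
          wedge (mixed b.Gam C B x) (h.gam A C x)) := by
    rw [← lower_eq_raise, ← hh.curv x hx A B, covDerivDown, sub_add_cancel]
  rw [covDerivDown, hw, extDeriv_covDerivDown hb.gam_symm_smooth hh.gam_symm_smooth hx]
  ext v
  rw [vec_eta_three v]
  fin_cases A <;> fin_cases B <;>
  · simp only [Fin.zero_eta, Fin.mk_one, Fin.sum_univ_two, spinAct,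
      raise_zero_zero, raise_zero_one, raise_one_zero, raise_one_one, mixed_zero, mixed_one,
      sS, sG, sσ, sγ, sw, hG, hσ, hγ,
      ContinuousAlternatingMap.add_apply, ContinuousAlternatingMap.sub_apply,
      ContinuousAlternatingMap.smul_apply, ContinuousAlternatingMap.neg_apply, smul_eq_mul,
      ContinuousAlternatingMap.coe_zero, Pi.zero_apply,
      wedge_two_one, wedge_one_two', wedge_one_one']
    ring

/-! ### Pure gauge solutions -/

theorem contDiffOn_contract {k : ℕ} {X Y : E4 → E4} {α : E4 → Form (k + 1)} {s : Set E4}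
    (hX : ContDiffOn ℝ ∞ X s) (hY : ContDiffOn ℝ ∞ Y s) (hα : ContDiffOn ℝ ∞ α s) :
    ContDiffOn ℝ ∞ (fun x => contract (X x) (Y x) (α x)) s := by
  let L : Form (k + 1) →L[ℝ] E4 →L[ℝ] Form k :=
    LinearMap.toContinuousBilinearMap <| LinearMap.mk₂ ℝ (fun α X => α.curryLeft X)
      (fun _ _ _ => rfl) (fun _ _ _ => rfl) (fun α _ _ => map_add α.curryLeft _ _)
      (fun c α _ => map_smul α.curryLeft c _)
  have h : (fun x => contract (X x) (Y x) (α x)) =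
      fun x => L (α x) (X x) + Complex.I • L (α x) (Y x) := rfl
  rw [h]
  have hs {f : E4 → Form k} (hf : ContDiffOn ℝ ∞ f s) :
      ContDiffOn ℝ ∞ (fun x => Complex.I • f x) s := hf.const_smul _
  exact ContDiffOn.add (by fun_prop) (hs (by fun_prop))

/-- The rotation `θ - ι_ξ Γ` compensated for the non-covariance of the Lie derivative. -/
def gaugeParameter (Γ : SpinForm 1) (X Y : E4 → E4) (θ : SpinForm 0) : SpinForm 0 :=
  fun A B x => θ A B x - contract (k := 0) (X x) (Y x) (Γ A B x)

theorem isSymmSmooth_gaugeParameter {Γ : SpinForm 1} {X Y : E4 → E4} {θ : SpinForm 0}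
    (hΓ : IsSymmSmooth Γ) (hX : ContDiffOn ℝ ∞ X spacetime) (hY : ContDiffOn ℝ ∞ Y spacetime)
    (hθ : IsSymmSmooth θ) : IsSymmSmooth (gaugeParameter Γ X Y θ) := by
  constructor
  · intro A B
    funext x
    simp only [gaugeParameter, hΓ.1 A B, hθ.1 A B]
  · intro A B
    exact (hθ.2 A B).sub (contDiffOn_contract (k := 0) hX hY (hΓ.2 A B))

/-- Cartan's formula reads £_ξ Γ = ι_ξ F + D(ι_ξ Γ), with F = (Λ/3) Σ on the background. The second
term is absorbed in the gauge parameter. -/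
theorem lieDeriv_sub_covDerivDown {Λ : ℝ} {b : Background} (hb : b.IsSelfDual Λ)
    {X Y : E4 → E4} {θ : SpinForm 0} (hX : ContDiffOn ℝ ∞ X spacetime)
    (hY : ContDiffOn ℝ ∞ Y spacetime) (hθ : IsSymmSmooth θ) {x : E4} (hx : x ∈ spacetime)
    (A B : Fin 2) :
    lieDeriv X Y (b.Gam A B) x - covDerivDown b.Gam θ A B x =
      ((Λ / 3 : ℝ) : ℂ) • contract (X x) (Y x) (raise b.Sig A B x)
        - covDerivDown b.Gam (gaugeParameter b.Gam X Y θ) A B x := by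
  have sG := hb.gam_symm_smooth.1 1 0
  have sθ := hθ.1 1 0
  have hG (A B : Fin 2) : extDeriv (b.Gam A B) x =
      ((Λ / 3 : ℝ) : ℂ) • raise b.Sig A B x -
        ∑ C, wedge (b.Gam A C x) (mixed b.Gam C B x) := by
    rw [← lower_eq_raise, ← hb.curv x hx A B, curvature, add_sub_cancel_right]
  have hd : extDeriv (gaugeParameter b.Gam X Y θ A B) x =
      extDeriv (θ A B) x -
        extDeriv (fun y => contract (k := 0) (X y) (Y y) (b.Gam A B y)) x := by
    have h : ∀ f : E4 → Form 0, extDeriv f x =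
      ContinuousAlternatingMap.alternatizeUncurryFinCLM ℝ E4 ℂ (fderiv ℝ f x) := fun f => rfl
    have h1 := differentiableAt_of_contDiffOn isOpen_spacetime
      (contDiffOn_contract (k := 0) hX hY (hb.gam_symm_smooth.2 A B)) hx
    rw [h, h, h, ← map_sub, ← fderiv_fun_sub (differentiableAt_of_symmSmooth hθ hx A B) h1]
    rfl
  have hc (η : Form 2) (u : E4) : contract (X x) (Y x) η ![u] =
    η ![X x, u] + Complex.I * η ![Y x, u] := rfl
  have hc0 (η : Form 1) : contract (k := 0) (X x) (Y x) η ![] =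
    η ![X x] + Complex.I * η ![Y x] := rfl
  rw [lieDeriv, covDerivDown, covDerivDown, hd]
  ext v
  rw [vec_eta_one v]
  simp only [ContinuousAlternatingMap.add_apply, ContinuousAlternatingMap.sub_apply,
    ContinuousAlternatingMap.smul_apply, hG, hc]
  fin_cases A <;> fin_cases B <;>
  · simp only [Fin.zero_eta, Fin.mk_one, Fin.sum_univ_two, gaugeParameter, hc0,
      raise_zero_zero, raise_zero_one, raise_one_zero, raise_one_one, mixed_zero, mixed_one,
      sG, sθ,
      ContinuousAlternatingMap.add_apply, ContinuousAlternatingMap.sub_apply,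
      ContinuousAlternatingMap.neg_apply, smul_eq_mul, wedge_one_zero', wedge_one_one]
    ring

theorem isSymmSmooth_weylAct {ψ : WeylSpinor} (hψ : IsWeyl ψ) {α : SpinForm 2}
    (hα : IsSymmSmooth α) : IsSymmSmooth (weylAct ψ α) := by
  constructor
  · intro A B
    funext x
    simp only [weylAct, fun C D => (hψ.1 A B C D).1]
  · intro A B
    have h (C D : Fin 2) : ContDiffOn ℝ ∞ (fun x => ψ A B C D x • α C D x) spacetime :=
      (hψ.2 A B C D).smul (hα.2 C D)
    exact ContDiffOn.sum fun C _ => ContDiffOn.sum fun D _ => h C D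

/-- The Weyl flux of a pure gauge solution is exact. -/
theorem pair_weylAct_of_gauge {Λ : ℝ} {b : Background} (hb : b.IsSelfDual Λ) {h k : State}
    (hk : k.IsSolution Λ b) {X Y : E4 → E4} {θ : SpinForm 0} (hX : ContDiffOn ℝ ∞ X spacetime)
    (hY : ContDiffOn ℝ ∞ Y spacetime) (hθ : IsSymmSmooth θ)
    (hg : ∀ x ∈ spacetime, ∀ A B,
      h.gam A B x = lieDeriv X Y (b.Gam A B) x - covDerivDown b.Gam θ A B x)
    {x : E4} (hx : x ∈ spacetime) :
    pair (raise h.gam) (weylAct k.psi b.Sig) (m := 3) (by omega) x =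
      -extDeriv (pair (raise (gaugeParameter b.Gam X Y θ)) (weylAct k.psi b.Sig)
        (m := 2) (by omega)) x := by
  have hτ := isSymmSmooth_gaugeParameter hb.gam_symm_smooth hX hY hθ
  have hw := isSymmSmooth_weylAct hk.psi_weyl hb.sig_symm_smooth
  rw [covariant_leibniz_zero_two hb.gam_symm_smooth.1 hτ.1 hw.1
    (differentiableAt_of_symmSmooth hτ hx) (differentiableAt_of_symmSmooth hw hx)]
  -- `hc` removes the ι_ξΣ₀ part of γ; `hD` removes the second term of the Leibniz rule, so that
  -- -D₀τ ∧ ψΣ₀ is exact.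
  have hc := contract_weylAct_eq_zero hk.psi_weyl hb.sig_symm_smooth.1 hb.tetrad hx (X x) (Y x)
  have hD := covDerivDown_weylAct hb hk hx
  have hγ (A B : Fin 2) : h.gam A B x =
      ((Λ / 3 : ℝ) : ℂ) • contract (X x) (Y x) (raise b.Sig A B x)
        - covDerivDown b.Gam (gaugeParameter b.Gam X Y θ) A B x :=
    (hg x hx A B).trans (lieDeriv_sub_covDerivDown hb hX hY hθ hx A B)
  have hcn (η : Form 2) : contract (X x) (Y x) (-η) = -contract (X x) (Y x) η := by
    ext w
    change -η (Matrix.vecCons (X x) w) + Complex.I * -η (Matrix.vecCons (Y x) w) =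
      -(η (Matrix.vecCons (X x) w) + Complex.I * η (Matrix.vecCons (Y x) w))
    ring
  ext v
  rw [vec_eta_three v]
  have e := congrArg (fun η : Form 3 => η ![v 0, v 1, v 2]) hc
  simp only [Fin.sum_univ_two, pair, raise_zero_zero, raise_zero_one, raise_one_zero,
    raise_one_one, hD, hγ, hcn, hb.sig_symm_smooth.1 1 0,
    ContinuousAlternatingMap.add_apply, ContinuousAlternatingMap.sub_apply,
    ContinuousAlternatingMap.smul_apply, ContinuousAlternatingMap.neg_apply, smul_eq_mul,
    ContinuousAlternatingMap.coe_zero, Pi.zero_apply, wedge_one_two, wedge_zero_left] at e ⊢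
  linear_combination ((Λ / 3 : ℝ) : ℂ) * e

/-! ### Integration over slices and shells -/

theorem hasDerivAt_integral_of_contDiff {K : Type*} [TopologicalSpace K] [CompactSpace K]
    [MeasurableSpace K] [BorelSpace K] [SecondCountableTopology K] {μ : Measure K}
    [IsFiniteMeasure μ] {f f' : ℝ → K → ℂ} (hf : Continuous (Function.uncurry f))
    (hf' : Continuous (Function.uncurry f')) (hd : ∀ t n, HasDerivAt (f · n) (f' t n) t) (t : ℝ) :
    HasDerivAt (fun t => ∫ n, f t n ∂μ) (∫ n, f' t n ∂μ) t := by
  obtain ⟨C, hC⟩ := ((isCompact_closedBall t 1).prod (isCompact_univ (X := K)))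
    |>.exists_bound_of_continuousOn
    hf'.continuousOn
  have hc (t : ℝ) : Continuous (f t) := hf.comp (Continuous.prodMk_right t)
  have hc' (t : ℝ) : Continuous (f' t) := hf'.comp (Continuous.prodMk_right t)
  have hi {g : K → ℂ} (hg : Continuous g) : Integrable g μ :=
    hg.integrable_of_hasCompactSupport (HasCompactSupport.of_compactSpace g)
  refine (hasDerivAt_integral_of_dominated_loc_of_deriv_le (bound := fun _ => C)
    (Metric.closedBall_mem_nhds t one_pos) (.of_forall fun s => (hc s).aestronglyMeasurable)
    (hi (hc t)) (hc' t).aestronglyMeasurable (.of_forall fun n s hs => hC (s, n) ⟨hs, trivial⟩)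
    (integrable_const C) (.of_forall fun n s _ => hd s n)).2

theorem integral_eq_integral_sphere {g : E4 → ℂ} (hg : Integrable g) :
    ∫ x, g x = ∫ r in Set.Ioi (0 : ℝ), (r ^ 3 : ℝ) •
      ∫ n : Metric.sphere (0 : E4) 1, g (r • (n : E4)) ∂((volume : Measure E4).toSphere) := by
  have mp := (volume : Measure E4).measurePreserving_homeomorphUnitSphereProd
  have hdim : Module.finrank ℝ E4 - 1 = 3 := by simp
  rw [hdim] at mp
  have emb := (homeomorphUnitSphereProd E4).measurableEmbedding
  set h : Metric.sphere (0 : E4) 1 × Set.Ioi (0 : ℝ) → ℂ := fun p => g ((p.2 : ℝ) • (p.1 : E4))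
  have hh (x : ({0}ᶜ : Set E4)) : h (homeomorphUnitSphereProd E4 x) = g x := by
    have : (x : E4) ≠ 0 := x.2
    simp [h, smul_smul, this]
  have hi : Integrable h ((volume : Measure E4).toSphere.prod (Measure.volumeIoiPow 3)) := by
    rw [← mp.integrable_comp_emb emb]
    have : h ∘ homeomorphUnitSphereProd E4 = fun x : ({0}ᶜ : Set E4) => g x := funext hh
    rw [this]
    exact (integrableOn_iff_comap_subtypeVal (measurableSet_singleton _).compl).1 hg.integrableOn
  calc
    ∫ x, g x = ∫ x : ({0}ᶜ : Set E4), g x ∂((volume : Measure E4).comap Subtype.val) := by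
      rw [integral_subtype_comap (measurableSet_singleton _).compl g, restrict_compl_singleton]
    _ = ∫ p, h p ∂((volume : Measure E4).toSphere.prod (Measure.volumeIoiPow 3)) := by
      rw [← mp.integral_comp emb]
      exact integral_congr_ae (.of_forall fun x => (hh x).symm)
    _ = ∫ r : Set.Ioi (0 : ℝ), ∫ n, h (n, r) ∂((volume : Measure E4).toSphere)
          ∂(Measure.volumeIoiPow 3) := integral_prod_symm _ hi
    _ = _ := by
      simp only [Measure.volumeIoiPow, ENNReal.ofReal]
      rw [integral_withDensity_eq_integral_smul (by fun_prop),
        integral_subtype_comap measurableSet_Ioi fun a => Real.toNNReal (a ^ 3) •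
          ∫ n : Metric.sphere (0 : E4) 1, g (a • (n : E4)) ∂((volume : Measure E4).toSphere)]
      refine setIntegral_congr_fun measurableSet_Ioi fun r hr => ?_
      simp only [NNReal.smul_def, Real.coe_toNNReal _ (pow_nonneg (le_of_lt hr) 3)]

theorem integral_fderiv_eq_zero {f : E4 → ℂ} (hf : ContDiff ℝ 1 f) (hc : HasCompactSupport f)
    (v : E4) : ∫ x, fderiv ℝ f x v = 0 := by
  have hf' : Continuous fun x => fderiv ℝ f x v := by fun_prop
  have hi : Integrable fun x => fderiv ℝ f x v :=
    hf'.integrable_of_hasCompactSupport (hc.fderiv_apply (𝕜 := ℝ) v)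
  -- Integration by parts against the constant function 1.
  have h := integral_mul_fderiv_eq_neg_fderiv_mul_of_integrable (𝕜 := ℂ) (μ := volume)
    (f := fun _ : E4 => (1 : ℂ)) (g := f) (v := v) (by simp) (by simpa using hi)
    (by simpa using hf.continuous.integrable_of_hasCompactSupport hc)
    (fun _ _ => by fun_prop) (fun x _ => hf.differentiable one_ne_zero x)
  simpa using h

/-- The divergence of a complex vector field on `ℝ⁴`. -/
def divergence (V : Fin 4 → E4 → ℂ) (x : E4) : ℂ := ∑ i, fderiv ℝ (V i) x (stdVec i)

/-- The outward flux of a complex vector field through the sphere of radius `t`. -/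
def sphereFlux (V : Fin 4 → E4 → ℂ) (t : ℝ) : ℂ :=
  ∫ n : Metric.sphere (0 : E4) 1, ((t ^ 3 : ℝ) : ℂ) *
    ∑ i, (((n : E4) i : ℝ) : ℂ) * V i (t • (n : E4)) ∂((volume : Measure E4).toSphere)

/-- Only the existence and continuity of the derivative matter here. It is identified with the
divergence integral later, by a weak argument. -/
theorem hasDerivAt_sphereFlux {V : Fin 4 → E4 → ℂ} (hV : ∀ i, ContDiff ℝ ∞ (V i)) :
    ∃ F' : ℝ → ℂ, Continuous F' ∧ ∀ t, HasDerivAt (sphereFlux V) (F' t) t := by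
  have hV' (i : Fin 4) : Continuous (fderiv ℝ (V i)) := (hV i).continuous_fderiv (by simp)
  have hVc (i : Fin 4) : Continuous (V i) := (hV i).continuous
  let f' : ℝ → Metric.sphere (0 : E4) 1 → ℂ := fun t n =>
    ((3 * t ^ 2 : ℝ) : ℂ) * ∑ i, (((n : E4) i : ℝ) : ℂ) * V i (t • (n : E4)) +
      ((t ^ 3 : ℝ) : ℂ) * ∑ i, (((n : E4) i : ℝ) : ℂ) * fderiv ℝ (V i) (t • (n : E4)) n
  have hf' : Continuous (Function.uncurry f') := by
    simp only [f', Function.uncurry_def]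
    fun_prop
  refine ⟨fun t => ∫ n, f' t n ∂((volume : Measure E4).toSphere), ?_, fun t => ?_⟩
  · simpa using continuous_parametric_integral_of_continuous
      (μ := (volume : Measure E4).toSphere) hf' isCompact_univ
  · refine hasDerivAt_integral_of_contDiff ?_ hf' (fun t n => ?_) t
    · simp only [Function.uncurry_def]
      fun_prop
    · have h1 : HasDerivAt (fun t : ℝ => ((t ^ 3 : ℝ) : ℂ)) ((3 * t ^ 2 : ℝ) : ℂ) t := by
        simpa using (hasDerivAt_pow 3 t).ofReal_comp
      have h2 (i : Fin 4) : HasDerivAt (fun t : ℝ => V i (t • (n : E4)))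
          (fderiv ℝ (V i) (t • (n : E4)) n) t := by
        have h3 : HasDerivAt (fun t : ℝ => t • (n : E4)) (n : E4) t := by
          simpa using (hasDerivAt_id t).smul_const (n : E4)
        exact ((hV i).differentiable (by simp) _).hasFDerivAt.comp_hasDerivAt t h3
      exact h1.mul (HasDerivAt.fun_sum fun i _ => (h2 i).const_mul _)

/-- The norm is smooth away from the origin, and the support condition makes the function vanish
near it. -/
theorem contDiff_radial {φ : ℝ → ℝ} (hφ : ContDiff ℝ ∞ φ) (hs : tsupport φ ⊆ Set.Ioi 0) :
    ContDiff ℝ ∞ fun x : E4 => φ ‖x‖ := by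
  rw [contDiff_iff_contDiffAt]
  intro x
  by_cases hx : x = 0
  · subst hx
    have h0 : (0 : ℝ) ∉ tsupport φ := fun h => lt_irrefl (0 : ℝ) (hs h)
    have h1 : ∀ᶠ r in 𝓝 (0 : ℝ), φ r = 0 := by
      simpa [EventuallyEq] using notMem_tsupport_iff_eventuallyEq.1 h0
    have h2 : Tendsto (fun x : E4 => ‖x‖) (𝓝 0) (𝓝 0) := by
      simpa using (continuous_norm (E := E4)).tendsto 0
    exact contDiffAt_const.congr_of_eventuallyEq (h2.eventually h1)
  · exact hφ.contDiffAt.comp x (contDiffAt_norm ℝ hx)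

theorem fderiv_radial {φ : ℝ → ℝ} (hφ : ContDiff ℝ ∞ φ) {x : E4} (hx : x ≠ 0) (i : Fin 4) :
    fderiv ℝ (fun x : E4 => φ ‖x‖) x (stdVec i) = deriv φ ‖x‖ * (x i / ‖x‖) := by
  have hn : ‖x‖ ≠ 0 := norm_ne_zero_iff.2 hx
  have h1 : HasFDerivAt (fun y : E4 => ‖y‖) ((1 / (2 * ‖x‖)) • (2 • innerSL ℝ x)) x := by
    have h := (hasStrictFDerivAt_norm_sq x).hasFDerivAt.sqrt (by positivity)
    simpa [Real.sqrt_sq (norm_nonneg _)] using h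
  have h2 := ((hφ.differentiable (by simp) ‖x‖).hasDerivAt.comp_hasFDerivAt x h1).fderiv
  have h3 : fderiv ℝ (fun x : E4 => φ ‖x‖) x = _ := h2
  rw [h3]
  simp [stdVec, EuclideanSpace.inner_single_right]
  field_simp
  exact Or.inl trivial

/-- In polar coordinates this is ∫ div(φ(|x|) V) = 0, the gradient of φ(|x|) being φ'(r) times the
outward normal. It says that r³ ∫ div V over the unit sphere is the distributional derivative of the
flux. -/
theorem weak_divergence {V : Fin 4 → E4 → ℂ} (hV : ∀ i, ContDiff ℝ ∞ (V i)) {φ : ℝ → ℝ}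
    (hφ : ContDiff ℝ ∞ φ) (hc : HasCompactSupport φ) (hs : tsupport φ ⊆ Set.Ioi 0) :
    ∫ r in Set.Ioi (0 : ℝ), (φ r • ((r ^ 3 : ℝ) • ∫ n : Metric.sphere (0 : E4) 1,
        divergence V (r • (n : E4)) ∂((volume : Measure E4).toSphere)) +
      deriv φ r • sphereFlux V r) = 0 := by
  have hΦ := contDiff_radial hφ hs
  have hcs (i : Fin 4) : HasCompactSupport fun x : E4 => φ ‖x‖ • V i x := by
    obtain ⟨R, hR⟩ := hc.isCompact.isBounded.subset_closedBall 0
    refine HasCompactSupport.of_support_subset_isCompact (isCompact_closedBall (0 : E4) R) ?_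
    intro x hx
    have h1 : φ ‖x‖ ≠ 0 := fun h => hx (by simp [h])
    have h2 := hR (subset_tsupport φ h1)
    simpa using h2
  have hcd (i : Fin 4) : ContDiff ℝ ∞ fun x : E4 => φ ‖x‖ • V i x := hΦ.smul (hV i)
  set g : E4 → ℂ := divergence fun i x => φ ‖x‖ • V i x
  have hgi (i : Fin 4) : Integrable fun x => fderiv ℝ (fun x : E4 => φ ‖x‖ • V i x) x (stdVec i) :=
    Continuous.integrable_of_hasCompactSupport
      (((hcd i).continuous_fderiv (by simp)).clm_apply continuous_const)
      ((hcs i).fderiv_apply (𝕜 := ℝ) (stdVec i))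
  have hg : Integrable g := integrable_finsetSum _ fun i _ => hgi i
  have h0 : ∫ x, g x = 0 := by
    have : ∫ x, g x = ∑ i, ∫ x, fderiv ℝ (fun x : E4 => φ ‖x‖ • V i x) x (stdVec i) :=
      integral_finsetSum _ fun i _ => hgi i
    rw [this]
    exact Finset.sum_eq_zero fun i _ =>
      integral_fderiv_eq_zero ((hcd i).of_le (by simp)) (hcs i) _
  rw [integral_eq_integral_sphere hg] at h0
  rw [← h0]
  refine setIntegral_congr_fun measurableSet_Ioi fun r hr => ?_
  have hr : (0 : ℝ) < r := hr
  have hgr (n : Metric.sphere (0 : E4) 1) : g (r • (n : E4)) =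
      φ r • divergence V (r • (n : E4)) +
        deriv φ r • ∑ i, (((n : E4) i : ℝ) : ℂ) * V i (r • (n : E4)) := by
    have hn : ‖(n : E4)‖ = 1 := by simp
    have hrn : ‖r • (n : E4)‖ = r := by rw [norm_smul, hn, mul_one, Real.norm_of_nonneg hr.le]
    have hne : r • (n : E4) ≠ 0 := by rw [← norm_ne_zero_iff, hrn]; exact hr.ne'
    simp only [g, divergence, Finset.smul_sum, ← Finset.sum_add_distrib]
    refine Finset.sum_congr rfl fun i _ => ?_
    rw [fderiv_fun_smul (hΦ.differentiable (by simp) _) ((hV i).differentiable (by simp) _)]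
    simp only [_root_.add_apply, _root_.smul_apply,
      ContinuousLinearMap.smulRight_apply, fderiv_radial hφ hne, hrn]
    simp [hr.ne']
    ring
  have hVc (i : Fin 4) : Continuous (V i) := (hV i).continuous
  have hV' (i : Fin 4) : Continuous (fderiv ℝ (V i)) := (hV i).continuous_fderiv (by simp)
  have hint {f : Metric.sphere (0 : E4) 1 → ℂ} (hf : Continuous f) :
      Integrable f ((volume : Measure E4).toSphere) :=
    hf.integrable_of_hasCompactSupport (HasCompactSupport.of_compactSpace f)
  simp only [hgr]
  rw [integral_add (hint (by unfold divergence; fun_prop)) (hint (by fun_prop)),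
    integral_smul, integral_smul, smul_add, sphereFlux, integral_const_mul]
  simp only [Complex.real_smul]
  ring

/-- The divergence theorem on a spherical shell. -/
theorem integral_divergence_shell {V : Fin 4 → E4 → ℂ} (hV : ∀ i, ContDiff ℝ ∞ (V i)) {s t : ℝ}
    (hs : 0 < s) (hst : s ≤ t) :
    ∫ x in shell s t, divergence V x = sphereFlux V t - sphereFlux V s := by
  obtain ⟨F', hF'c, hF'⟩ := hasDerivAt_sphereFlux hV
  have hV' (i : Fin 4) : Continuous (fderiv ℝ (V i)) := (hV i).continuous_fderiv (by simp)
  have hdc : Continuous (divergence V) := by unfold divergence; fun_prop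
  set G : ℝ → ℂ := fun r => (r ^ 3 : ℝ) • ∫ n : Metric.sphere (0 : E4) 1,
    divergence V (r • (n : E4)) ∂((volume : Measure E4).toSphere)
  have hG : Continuous G := by
    have h1 : Continuous fun r : ℝ => ∫ n : Metric.sphere (0 : E4) 1,
        divergence V (r • (n : E4)) ∂((volume : Measure E4).toSphere) := by
      simpa using continuous_parametric_integral_of_continuous
        (μ := (volume : Measure E4).toSphere)
        (f := fun (r : ℝ) (n : Metric.sphere (0 : E4) 1) => divergence V (r • (n : E4)))
        (by simp only [Function.uncurry_def]; fun_prop) isCompact_univ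
    fun_prop
  have hFc : Continuous (sphereFlux V) :=
    continuous_iff_continuousAt.2 fun t => (hF' t).continuousAt
  -- `G` and `F'` are both weak derivatives of the flux on r > 0, the first by `weak_divergence` and
  -- the second by integrating (φ · flux)'. Hence they agree almost everywhere.
  have key : ∀ᵐ r : ℝ, r ∈ Set.Ioi (0 : ℝ) → G r - F' r = 0 := by
    refine isOpen_Ioi.ae_eq_zero_of_integral_contDiff_smul_eq_zero
      ((hG.sub hF'c).locallyIntegrable.locallyIntegrableOn _) fun φ hφ hc hφs => ?_
    have hw := weak_divergence hV hφ hc hφs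
    have hφ0 (r : ℝ) (hr : r ∉ Set.Ioi (0 : ℝ)) : φ r = 0 ∧ deriv φ r = 0 := by
      have h1 : r ∉ tsupport φ := fun h => hr (hφs h)
      exact ⟨image_eq_zero_of_notMem_tsupport h1,
        image_eq_zero_of_notMem_tsupport fun h => h1 (tsupport_deriv_subset h)⟩
    rw [setIntegral_eq_integral_of_forall_compl_eq_zero
      fun r hr => by simp [hφ0 r hr]] at hw
    have hφ' : Continuous (deriv φ) := hφ.continuous_deriv (by simp)
    have hφc : Continuous φ := hφ.continuous
    have hi {f : ℝ → ℂ} (hf : Continuous f) : Integrable fun r => φ r • f r :=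
      (hφc.smul hf).integrable_of_hasCompactSupport hc.smul_right
    have hi' {f : ℝ → ℂ} (hf : Continuous f) : Integrable fun r => deriv φ r • f r :=
      (hφ'.smul hf).integrable_of_hasCompactSupport hc.deriv.smul_right
    have hp : ∫ r, (φ r • F' r + deriv φ r • sphereFlux V r) = 0 := by
      refine integral_eq_zero_of_hasDerivAt_of_integrable (f := fun r => φ r • sphereFlux V r)
        (fun r => ?_) ((hi hF'c).add (hi' hFc)) (hi hFc)
      exact (hφ.differentiable (by simp) r).hasDerivAt.smul (hF' r)
    rw [integral_add (hi hG) (hi' hFc)] at hw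
    rw [integral_add (hi hF'c) (hi' hFc)] at hp
    simp only [smul_sub]
    rw [integral_sub (hi hG) (hi hF'c)]
    linear_combination hw - hp
  have h1 : ∫ r in s..t, F' r = sphereFlux V t - sphereFlux V s :=
    intervalIntegral.integral_eq_sub_of_hasDerivAt (fun r _ => hF' r)
      (hF'c.intervalIntegrable s t)
  have hm : MeasurableSet (shell s t) := (isOpen_shell s t).measurableSet
  have hi : Integrable ((shell s t).indicator (divergence V)) := by
    rw [integrable_indicator_iff hm]
    refine (hdc.continuousOn.integrableOn_compact (isCompact_closedBall (0 : E4) t)).mono_set ?_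
    intro x hx
    simpa using hx.2.le
  rw [← integral_indicator hm, integral_eq_integral_sphere hi, ← h1,
    intervalIntegral.integral_of_le hst, ← integral_Ioc_eq_integral_Ioo.symm,
    ← integral_indicator measurableSet_Ioi, ← integral_indicator measurableSet_Ioo]
  refine integral_congr_ae ?_
  filter_upwards [key] with r hr
  by_cases hr0 : r ∈ Set.Ioi (0 : ℝ)
  · rw [Set.indicator_of_mem hr0]
    have hnr (n : Metric.sphere (0 : E4) 1) : ‖r • (n : E4)‖ = r := by
      have hn : ‖(n : E4)‖ = 1 := by simp
      rw [norm_smul, hn, mul_one, Real.norm_of_nonneg (le_of_lt hr0)]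
    by_cases hrst : r ∈ Set.Ioo s t
    · have h2 (n : Metric.sphere (0 : E4) 1) : r • (n : E4) ∈ shell s t := by
        change s < ‖_‖ ∧ ‖_‖ < t
        rwa [hnr]
      simp only [Set.indicator_of_mem (h2 _), Set.indicator_of_mem hrst]
      exact sub_eq_zero.1 (hr hr0)
    · have h2 (n : Metric.sphere (0 : E4) 1) : r • (n : E4) ∉ shell s t := by
        change ¬(s < ‖_‖ ∧ ‖_‖ < t)
        rwa [hnr]
      simp [Set.indicator_of_notMem (h2 _), Set.indicator_of_notMem hrst]
  · have h3 : r ∉ Set.Ioo s t := fun h => hr0 (hs.trans h.1)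
    rw [Set.indicator_of_notMem hr0, Set.indicator_of_notMem h3]

/-! ### Stokes' theorem -/

/-- The vector field dual to a `3`-form. -/
def dualField (α : E4 → Form 3) (i : Fin 4) (x : E4) : ℂ :=
  (-1 : ℂ) ^ (i : ℕ) * α x (fun j : Fin 3 => stdVec (i.succAbove j))

theorem contDiff_dualField {α : E4 → Form 3} (hα : ContDiff ℝ ∞ α) (i : Fin 4) :
    ContDiff ℝ ∞ (dualField α i) := by
  have h := (ContinuousAlternatingMap.apply ℝ E4 ℂ
    fun j : Fin 3 => stdVec (i.succAbove j)).contDiff.comp hα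
  exact contDiff_const.mul h

theorem sliceIntegral_eq_sphereFlux (t : ℝ) (α : E4 → Form 3) :
    sliceIntegral t α = sphereFlux (dualField α) t := by
  rw [sliceIntegral, sphereFlux, integral_const_mul]
  congr 1
  refine integral_congr_ae (.of_forall fun n => Finset.sum_congr rfl fun i _ => ?_)
  simp only [dualField]
  ring

theorem density_extDeriv {α : E4 → Form 3} {x : E4} (hα : DifferentiableAt ℝ α x) :
    density (extDeriv α) x = divergence (dualField α) x := by
  rw [density, extDeriv_apply hα, divergence]
  refine Finset.sum_congr rfl fun i _ => ?_
  have h : DifferentiableAt ℝ (fun y => α y (fun j : Fin 3 => stdVec (i.succAbove j))) x :=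
    (ContinuousAlternatingMap.apply ℝ E4 ℂ
      fun j : Fin 3 => stdVec (i.succAbove j)).differentiableAt.comp x hα
  have h1 : fderiv ℝ (dualField α i) x = _ := fderiv_const_mul h ((-1 : ℂ) ^ (i : ℕ))
  rw [h1]
  simp
  rfl

/-- A radial cut-off equal to `1` near `a ≤ |x| ≤ b` and vanishing for `|x|` outside `[a', b']`. -/
theorem exists_radial_cutoff {a' a b b' : ℝ} (ha' : 0 < a') (ha : a' < a) (hb : b < b')
    (hab : a ≤ b) :
    ∃ χ : E4 → ℝ, ContDiff ℝ ∞ χ ∧ (∀ x, a ≤ ‖x‖ → ‖x‖ ≤ b → χ x = 1) ∧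
      ∀ x, ‖x‖ ≤ a' ∨ b' ≤ ‖x‖ → χ x = 0 := by
  refine ⟨fun x => Real.smoothTransition ((‖x‖ ^ 2 - a' ^ 2) / (a ^ 2 - a' ^ 2)) *
    Real.smoothTransition ((b' ^ 2 - ‖x‖ ^ 2) / (b' ^ 2 - b ^ 2)), ?_, ?_, ?_⟩
  · refine (Real.smoothTransition.contDiff.comp ?_).mul (Real.smoothTransition.contDiff.comp ?_)
    · exact ((contDiff_norm_sq ℝ).sub contDiff_const).div_const _
    · exact (contDiff_const.sub (contDiff_norm_sq ℝ)).div_const _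
  · intro x h1 h2
    beta_reduce
    have p1 : 0 < a ^ 2 - a' ^ 2 := by nlinarith
    have p2 : 0 < b' ^ 2 - b ^ 2 := by nlinarith
    rw [Real.smoothTransition.one_of_one_le ((one_le_div p1).2 (by nlinarith)),
      Real.smoothTransition.one_of_one_le ((one_le_div p2).2 (by nlinarith [norm_nonneg x])),
      mul_one]
  · intro x hx
    beta_reduce
    have p1 : 0 < a ^ 2 - a' ^ 2 := by nlinarith
    have p2 : 0 < b' ^ 2 - b ^ 2 := by nlinarith
    rcases hx with hx | hx
    · rw [Real.smoothTransition.zero_of_nonpos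
        (div_nonpos_of_nonpos_of_nonneg (by nlinarith [norm_nonneg x]) p1.le), zero_mul]
    · rw [Real.smoothTransition.zero_of_nonpos
        (div_nonpos_of_nonpos_of_nonneg (by nlinarith) p2.le), mul_zero]

/-- A form on the space-time extends to a form on `ℝ⁴` agreeing with it on a given closed shell and
vanishing inside a given sphere. -/
theorem exists_form_extension {k : ℕ} {α : E4 → Form k} (hα : ContDiffOn ℝ ∞ α spacetime)
    {a' a b : ℝ} (ha' : 1 < a') (ha : a' < a) (hab : a ≤ b) (hb : b < 2) :
    ∃ β : E4 → Form k, ContDiff ℝ ∞ β ∧ (∀ x, a ≤ ‖x‖ → ‖x‖ ≤ b → β x = α x) ∧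
      ∀ x, ‖x‖ ≤ a' → β x = 0 := by
  -- The outer radius is the midpoint of `b` and 2, so the cut-off vanishes before α stops being
  -- smooth.
  obtain ⟨χ, hχ, h1, h0⟩ := exists_radial_cutoff (a' := a') (a := a) (b := b) (b' := (b + 2) / 2)
    (by linarith) ha (by linarith) hab
  refine ⟨fun x => χ x • α x, ?_, fun x hx hx' => by ext v; simp [h1 x hx hx'],
    fun x hx => by ext v; simp [h0 x (.inl hx)]⟩
  rw [contDiff_iff_contDiffAt]
  intro x
  by_cases hx : x ∈ spacetime
  · exact hχ.contDiffAt.smul (hα.contDiffAt (isOpen_spacetime.mem_nhds hx))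
  · have hx' : ‖x‖ < a' ∨ (b + 2) / 2 < ‖x‖ := by
      by_contra hcon
      push Not at hcon
      exact hx ⟨by linarith [hcon.1], by linarith [hcon.2]⟩
    have hev : ∀ᶠ y in 𝓝 x, ‖y‖ < a' ∨ (b + 2) / 2 < ‖y‖ :=
      ((isOpen_lt continuous_norm continuous_const).union
        (isOpen_lt continuous_const continuous_norm)).mem_nhds hx'
    refine (contDiffAt_const (c := (0 : Form k))).congr_of_eventuallyEq ?_
    filter_upwards [hev] with y hy
    ext v
    simp [h0 y (hy.imp le_of_lt le_of_lt)]

theorem stokes_shell_of_contDiff {α : E4 → Form 3} (hα : ContDiff ℝ ∞ α) {s t : ℝ} (hs : 0 < s)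
    (hst : s ≤ t) :
    ∫ x in shell s t, density (extDeriv α) x = sliceIntegral t α - sliceIntegral s α := by
  simp only [density_extDeriv (hα.differentiable (by simp) _), sliceIntegral_eq_sphereFlux]
  exact integral_divergence_shell (contDiff_dualField hα) hs hst

theorem sliceIntegral_congr {α β : E4 → Form 3} {t : ℝ} (ht : 0 ≤ t)
    (h : ∀ x, ‖x‖ = t → α x = β x) : sliceIntegral t α = sliceIntegral t β := by
  unfold sliceIntegral
  congr 1
  refine integral_congr_ae (.of_forall fun n => Finset.sum_congr rfl fun i _ => ?_)
  have hn : ‖t • (n : E4)‖ = t := by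
    rw [norm_smul, norm_eq_of_mem_sphere, mul_one, Real.norm_of_nonneg ht]
  simp only [h _ hn]

/-- Stokes' theorem on the shell between two slices. -/
theorem stokes_shell {α : E4 → Form 3} (hα : ContDiffOn ℝ ∞ α spacetime) {s t : ℝ} (hs : 1 < s)
    (hst : s ≤ t) (ht : t < 2) :
    ∫ x in shell s t, density (extDeriv α) x = sliceIntegral t α - sliceIntegral s α := by
  obtain ⟨β, hβ, h1, -⟩ := exists_form_extension hα (a' := (1 + s) / 2) (by linarith)
    (by linarith : (1 + s) / 2 < s) hst ht
  rw [sliceIntegral_congr (by linarith) fun x hx => (h1 x (by linarith) hx.le).symm,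
    sliceIntegral_congr (by linarith) fun x hx => (h1 x hx.ge (by linarith)).symm,
    ← stokes_shell_of_contDiff hβ (by linarith) hst]
  refine setIntegral_congr_fun (isOpen_shell s t).measurableSet fun x hx => ?_
  have he : α =ᶠ[𝓝 x] β := by
    filter_upwards [(isOpen_shell s t).mem_nhds hx] with y hy
    exact (h1 y hy.1.le hy.2.le).symm
  simp only [density, he.extDeriv_eq]

/-- The integral of an exact form over a slice vanishes. -/
theorem sliceIntegral_extDeriv {β : E4 → Form 2} (hβ : ContDiffOn ℝ ∞ β spacetime) {t : ℝ}
    (ht : 1 < t) (ht' : t < 2) : sliceIntegral t (extDeriv β) = 0 := by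
  -- Extend β so that it is unchanged near C_t and zero for |x| ≤ (1+t)/2. As d(dγ) = 0, the flux of
  -- dγ through C_t equals that through the sphere of radius `s`, the midpoint of 1 and (1+t)/2,
  -- where γ vanishes identically.
  obtain ⟨γ, hγ, h1, h0⟩ := exists_form_extension hβ (a' := (1 + t) / 2) (a := (1 + 3 * t) / 4)
    (b := (t + 2) / 2) (by linarith) (by linarith) (by linarith) (by linarith)
  set s : ℝ := (3 + t) / 4
  have hγ' : ContDiff ℝ ∞ (extDeriv γ) := by
    rw [← contDiffOn_univ]
    exact contDiffOn_extDeriv isOpen_univ hγ.contDiffOn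
  have h2 : sliceIntegral t (extDeriv β) = sliceIntegral t (extDeriv γ) := by
    refine sliceIntegral_congr (by linarith) fun x hx => ?_
    have he : β =ᶠ[𝓝 x] γ := by
      have : x ∈ shell ((1 + 3 * t) / 4) ((t + 2) / 2) :=
        ⟨by rw [hx]; linarith, by rw [hx]; linarith⟩
      filter_upwards [(isOpen_shell _ _).mem_nhds this] with y hy
      exact (h1 y hy.1.le hy.2.le).symm
    exact he.extDeriv_eq
  have h3 : sliceIntegral s (extDeriv γ) = 0 := by
    rw [sliceIntegral_congr (β := fun _ => 0) (by simp only [s]; linarith) fun x hx => ?_]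
    · simp [sliceIntegral]
    · have he : γ =ᶠ[𝓝 x] fun _ => 0 := by
        have : ‖x‖ < (1 + t) / 2 := by rw [hx]; simp only [s]; linarith
        filter_upwards [(isOpen_lt continuous_norm continuous_const).mem_nhds this] with y hy
        exact h0 y (le_of_lt hy)
      rw [he.extDeriv_eq]
      ext v
      simp [extDeriv, ContinuousAlternatingMap.alternatizeUncurryFin_apply]
  have h4 := stokes_shell_of_contDiff hγ' (s := s) (t := t) (by simp only [s]; linarith)
    (by simp only [s]; linarith)
  have h5 (x : E4) : extDeriv (extDeriv γ) x = 0 :=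
    extDeriv_extDeriv_apply hγ.contDiffAt (by
      rw [minSmoothness_of_isRCLikeNormedField]
      exact ENat.LEInfty.out)
  have h6 : ∫ x in shell s t, density (extDeriv (extDeriv γ)) x = 0 := by simp [density, h5]
  rw [h2]
  linear_combination h6 - h4 + h3

theorem sliceIntegral_integrable {α : E4 → Form 3} (hα : ContDiffOn ℝ ∞ α spacetime) {t : ℝ}
    (ht : 1 < t) (ht' : t < 2) :
    Integrable (fun n : Metric.sphere (0 : E4) 1 =>
      ∑ i : Fin 4, ((-1 : ℂ) ^ (i : ℕ)) * (((n : E4) i : ℝ) : ℂ) *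
      α (t • (n : E4)) (fun j : Fin 3 => stdVec (i.succAbove j)))
      ((volume : Measure E4).toSphere) := by
  have hc : Continuous fun n : Metric.sphere (0 : E4) 1 => α (t • (n : E4)) := by
    refine hα.continuousOn.comp_continuous (by fun_prop) fun n => ?_
    have hn : ‖t • (n : E4)‖ = t := by
      rw [norm_smul, norm_eq_of_mem_sphere, mul_one, Real.norm_of_nonneg (by linarith)]
    exact ⟨by rwa [hn], by rwa [hn]⟩
  refine Continuous.integrable_of_hasCompactSupport ?_ (HasCompactSupport.of_compactSpace _)
  refine continuous_finsetSum _ fun i _ => Continuous.mul (by fun_prop) ?_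
  exact (ContinuousAlternatingMap.apply ℝ E4 ℂ
    (fun j : Fin 3 => stdVec (i.succAbove j))).continuous.comp hc

theorem sliceIntegral_add {α β : E4 → Form 3} (hα : ContDiffOn ℝ ∞ α spacetime)
    (hβ : ContDiffOn ℝ ∞ β spacetime) {t : ℝ} (ht : 1 < t) (ht' : t < 2) :
    sliceIntegral t (fun x => α x + β x) = sliceIntegral t α + sliceIntegral t β := by
  unfold sliceIntegral
  rw [← mul_add, ← integral_add (sliceIntegral_integrable hα ht ht')
    (sliceIntegral_integrable hβ ht ht')]
  simp only [ContinuousAlternatingMap.add_apply, mul_add, Finset.sum_add_distrib]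

theorem sliceIntegral_smul (c : ℂ) (α : E4 → Form 3) (t : ℝ) :
    sliceIntegral t (fun x => c • α x) = c * sliceIntegral t α := by
  unfold sliceIntegral
  rw [mul_left_comm]
  congr 1
  refine Eq.trans (integral_congr_ae (.of_forall fun n : Metric.sphere (0 : E4) 1 => ?_))
    (integral_const_mul c _)
  simp only [ContinuousAlternatingMap.smul_apply, smul_eq_mul, Finset.mul_sum]
  exact Finset.sum_congr rfl fun i _ => by ring

/-! ### The generating functional -/

section

variable {κ Λ : ℝ} {b : Background} {h k : State}

theorem contDiffOn_sig_gam (hh : h.IsSolution Λ b) (hk : k.IsSolution Λ b) :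
    ContDiffOn ℝ ∞ (pair h.sig k.gam (m := 3) (by omega)) spacetime :=
  contDiffOn_pair _ hh.sig_symm_smooth hk.gam_symm_smooth

theorem bulkForm_eq (hb : b.IsSelfDual Λ) (hh : h.IsSolution Λ b) (hk : k.IsSolution Λ b)
    {x : E4} (hx : x ∈ spacetime) :
    bulkForm κ Λ b h k x = (-(Complex.I / (κ : ℂ) ^ 2)) •
      extDeriv (pair h.sig k.gam (m := 3) (by omega)) x := by
  rw [extDeriv_pair_sig_gam hb hh hk hx, bulkForm, neg_smul, smul_neg, neg_neg]

theorem shell_subset_spacetime {s t : ℝ} (hs : 1 ≤ s) (ht : t ≤ 2) : shell s t ⊆ spacetime :=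
  fun _ hx => ⟨hs.trans_lt hx.1, hx.2.trans_le ht⟩

theorem integral_bulkForm (hb : b.IsSelfDual Λ) (hh : h.IsSolution Λ b) (hk : k.IsSolution Λ b)
    {s t : ℝ} (hs : 1 < s) (hst : s ≤ t) (ht : t < 2) :
    ∫ x in shell s t, density (bulkForm κ Λ b h k) x =
      -(Complex.I / (κ : ℂ) ^ 2) * (slicePairing t h k - slicePairing s h k) := by
  rw [slicePairing, slicePairing, ← stokes_shell (contDiffOn_sig_gam hh hk) hs hst ht,
    ← integral_const_mul]
  refine setIntegral_congr_fun (isOpen_shell s t).measurableSet fun x hx => ?_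
  simp only [density]
  rw [bulkForm_eq hb hh hk (shell_subset_spacetime hs.le ht.le hx)]
  rfl

theorem eventually_shell : ∀ᶠ p : ℝ × ℝ in 𝓝[>] (1 : ℝ) ×ˢ 𝓝[<] (2 : ℝ),
    1 < p.1 ∧ p.1 ≤ p.2 ∧ p.2 < 2 := by
  have h1 : ∀ᶠ s in 𝓝[>] (1 : ℝ), s ∈ Set.Ioo (1 : ℝ) (3 / 2) :=
    Ioo_mem_nhdsGT (by norm_num)
  have h2 : ∀ᶠ t in 𝓝[<] (2 : ℝ), t ∈ Set.Ioo (3 / 2 : ℝ) 2 :=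
    Ioo_mem_nhdsLT (by norm_num)
  filter_upwards [h1.prod_mk h2] with p hp
  exact ⟨hp.1.1, (hp.1.2.trans hp.2.1).le, hp.2.2⟩

/-- By Stokes the shell integral is the inner product on the outer slice minus a multiple of the
pairing on the inner slice, and the latter tends to zero. -/
theorem hasBulkIntegral_iff_tendsto (hb : b.IsSelfDual Λ) (hh : h.IsSolution Λ b)
    (hk : k.IsSolution Λ b) (hpast : Tendsto (fun t => slicePairing t h k) (𝓝[>] (1 : ℝ)) (𝓝 0))
    (I : ℂ) : HasAmplitude κ k h I ↔ HasBulkIntegral (bulkForm κ Λ b h k) I := by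
  have hz : Tendsto (fun p : ℝ × ℝ => -(Complex.I / (κ : ℂ) ^ 2) * slicePairing p.1 h k)
      (𝓝[>] (1 : ℝ) ×ˢ 𝓝[<] (2 : ℝ)) (𝓝 0) := by
    simpa using (hpast.comp tendsto_fst).const_mul (-(Complex.I / (κ : ℂ) ^ 2))
  have e : (fun p : ℝ × ℝ => ∫ x in shell p.1 p.2, density (bulkForm κ Λ b h k) x)
      =ᶠ[𝓝[>] (1 : ℝ) ×ˢ 𝓝[<] (2 : ℝ)]
      fun p => inner κ p.2 k h - -(Complex.I / (κ : ℂ) ^ 2) * slicePairing p.1 h k := by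
    filter_upwards [eventually_shell] with p hp
    rw [integral_bulkForm hb hh hk hp.1 hp.2.1 hp.2.2, inner, mul_sub]
  rw [HasBulkIntegral, tendsto_congr' e, HasAmplitude]
  -- A function of the outer radius alone has the same limit along the product filter, because the
  -- filter of inner radii is nontrivial.
  have h2 : Tendsto (fun t => inner κ t k h) (𝓝[<] (2 : ℝ)) (𝓝 I) ↔
      Tendsto (fun p : ℝ × ℝ => inner κ p.2 k h) (𝓝[>] (1 : ℝ) ×ˢ 𝓝[<] (2 : ℝ)) (𝓝 I) := by
    have hm : Filter.map Prod.snd (𝓝[>] (1 : ℝ) ×ˢ 𝓝[<] (2 : ℝ)) = 𝓝[<] (2 : ℝ) :=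
      map_snd_prod _ _
    rw [← hm, tendsto_map'_iff]
    rw [hm]
    rfl
  rw [h2]
  constructor
  · intro h
    simpa using h.sub hz
  · intro h
    simpa using h.add hz

/-- Dominated convergence: each point of M lies in all sufficiently large shells, and the modulus of
the density on M dominates. -/
theorem hasBulkIntegral_of_integrableOn {η : E4 → Form 4}
    (hη : IntegrableOn (density η) spacetime) :
    HasBulkIntegral η (∫ x in spacetime, density η x) := by
  have hm (s t : ℝ) : MeasurableSet (shell s t) := (isOpen_shell s t).measurableSet
  unfold HasBulkIntegral
  simp only [← integral_indicator (hm _ _),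
    ← integral_indicator (isOpen_spacetime.measurableSet)]
  refine tendsto_integral_filter_of_dominated_convergence
    (spacetime.indicator fun x => ‖density η x‖) ?_ ?_ ?_ ?_
  · filter_upwards [eventually_shell] with p hp
    exact ((hη.mono_set (shell_subset_spacetime hp.1.le hp.2.2.le)).integrable_indicator
      (hm _ _)).aestronglyMeasurable
  · filter_upwards [eventually_shell] with p hp
    refine .of_forall fun x => ?_
    by_cases hx : x ∈ shell p.1 p.2
    · rw [Set.indicator_of_mem hx,
        Set.indicator_of_mem (shell_subset_spacetime hp.1.le hp.2.2.le hx)]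
    · rw [Set.indicator_of_notMem hx, norm_zero]
      exact Set.indicator_nonneg (fun _ _ => norm_nonneg _) x
  · exact IntegrableOn.integrable_indicator hη.norm isOpen_spacetime.measurableSet
  · refine .of_forall fun x => ?_
    refine tendsto_const_nhds.congr' ?_
    by_cases hx : x ∈ spacetime
    · have h1 : ∀ᶠ s in 𝓝[>] (1 : ℝ), s ∈ Set.Ioo (1 : ℝ) ‖x‖ := Ioo_mem_nhdsGT hx.1
      have h2 : ∀ᶠ t in 𝓝[<] (2 : ℝ), t ∈ Set.Ioo ‖x‖ (2 : ℝ) := Ioo_mem_nhdsLT hx.2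
      filter_upwards [h1.prod_mk h2] with p hp
      have hp' : x ∈ shell p.1 p.2 := ⟨hp.1.2, hp.2.1⟩
      rw [Set.indicator_of_mem hx, Set.indicator_of_mem hp']
    · filter_upwards [eventually_shell] with p hp
      rw [Set.indicator_of_notMem hx, Set.indicator_of_notMem
        fun h => hx (shell_subset_spacetime hp.1.le hp.2.2.le h)]

/-- The symplectic product of two solutions is determined by their Weyl fluxes. -/
theorem slicePairing_sub (hb : b.IsSelfDual Λ) (hh : h.IsSolution Λ b) (hk : k.IsSolution Λ b)
    {t : ℝ} (ht : 1 < t) (ht' : t < 2) :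
    ((Λ / 3 : ℝ) : ℂ) * (slicePairing t h k - slicePairing t k h) =
      weylFlux b t h k - weylFlux b t k h := by
  have w (h k : State) (hh : h.IsSolution Λ b) (hk : k.IsSolution Λ b) :
      ContDiffOn ℝ ∞ (pair (raise h.gam) (weylAct k.psi b.Sig) (m := 3) (by omega)) spacetime :=
    contDiffOn_pair _ (isSymmSmooth_raise hh.gam_symm_smooth)
      (isSymmSmooth_weylAct hk.psi_weyl hb.sig_symm_smooth)
  have hβ : ContDiffOn ℝ ∞ (pair (raise h.gam) k.gam (m := 2) (by omega)) spacetime :=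
    contDiffOn_pair _ (isSymmSmooth_raise hh.gam_symm_smooth) hk.gam_symm_smooth
  have hneg {α : E4 → Form 3} (hα : ContDiffOn ℝ ∞ α spacetime) :
      ContDiffOn ℝ ∞ (fun x => (-1 : ℂ) • α x) spacetime := hα.const_smul _
  have p1 := contDiffOn_sig_gam hh hk
  have p2 := contDiffOn_sig_gam hk hh
  have e1 : sliceIntegral t (fun x => ((Λ / 3 : ℝ) : ℂ) •
      -- Differences are written as sums with a factor -1, so that additivity and homogeneity of the
      -- slice integral suffice.
      (pair h.sig k.gam (m := 3) (by omega) x + (-1 : ℂ) •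
        pair k.sig h.gam (m := 3) (by omega) x)) =
      sliceIntegral t (fun x => (extDeriv (pair (raise h.gam) k.gam (m := 2) (by omega)) x
      + pair (raise h.gam) (weylAct k.psi b.Sig) (m := 3) (by omega) x)
      + (-1 : ℂ) • pair (raise k.gam) (weylAct h.psi b.Sig) (m := 3) (by omega) x) := by
    refine sliceIntegral_congr (by linarith) fun x hx => ?_
    have hx' : x ∈ spacetime := ⟨by rwa [hx], by rwa [hx]⟩
    have e := pair_sub_pair hb hh hk hx'
    ext v
    have e' := congrArg (fun η : Form 3 => η v) e
    simp only [ContinuousAlternatingMap.add_apply, ContinuousAlternatingMap.sub_apply,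
      ContinuousAlternatingMap.smul_apply, smul_eq_mul] at e' ⊢
    linear_combination e'
  have d1 := contDiffOn_extDeriv isOpen_spacetime hβ
  rw [sliceIntegral_smul, sliceIntegral_add p1 (hneg p2) ht ht', sliceIntegral_smul,
    sliceIntegral_add (d1.add (w h k hh hk)) (hneg (w k h hk hh)) ht ht',
    sliceIntegral_add d1 (w h k hh hk) ht ht', sliceIntegral_smul,
    sliceIntegral_extDeriv hβ ht ht'] at e1
  simp only [slicePairing, weylFlux]
  linear_combination e1

/-- The symplectic product of two solutions is conserved. -/
theorem slicePairing_sub_const (hb : b.IsSelfDual Λ) (hh : h.IsSolution Λ b)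
    (hk : k.IsSolution Λ b) {s t : ℝ} (hs : 1 < s) (hs' : s < 2) (ht : 1 < t) (ht' : t < 2) :
    slicePairing s h k - slicePairing s k h = slicePairing t h k - slicePairing t k h := by
  wlog hst : s ≤ t generalizing s t
  · exact (this ht ht' hs hs' (le_of_not_ge hst)).symm
  -- Exchanging the solutions in the cubic term gives one sign from the two 1-forms and another from
  -- ε in the contracted index; the σ ∧ σ term is plainly symmetric.
  have hsymm (x : E4) (hx : x ∈ spacetime) :
      extDeriv (pair h.sig k.gam (m := 3) (by omega)) x =
        extDeriv (pair k.sig h.gam (m := 3) (by omega)) x := by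
    have sS := hb.sig_symm_smooth.1 1 0
    have sσ := hh.sig_symm_smooth.1 1 0
    have sσ' := hk.sig_symm_smooth.1 1 0
    have sγ := hh.gam_symm_smooth.1 1 0
    have sγ' := hk.gam_symm_smooth.1 1 0
    rw [extDeriv_pair_sig_gam hb hh hk hx, extDeriv_pair_sig_gam hb hk hh hx]
    ext v
    rw [vec_eta_four v]
    simp only [Fin.sum_univ_two, sS, sσ, sσ', sγ, sγ', cubic, pair, lower_eq_raise,
      raise_zero_zero, raise_zero_one, raise_one_zero, raise_one_one, mixed_zero, mixed_one,
      ContinuousAlternatingMap.add_apply, ContinuousAlternatingMap.sub_apply,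
      ContinuousAlternatingMap.smul_apply, ContinuousAlternatingMap.neg_apply, smul_eq_mul,
      wedge_two_two, wedge_one_one]
    ring
  have h1 := stokes_shell (contDiffOn_sig_gam hh hk) hs hst ht'
  have h2 := stokes_shell (contDiffOn_sig_gam hk hh) hs hst ht'
  have h3 : ∫ x in shell s t, density (extDeriv (pair h.sig k.gam (m := 3) (by omega))) x =
      ∫ x in shell s t, density (extDeriv (pair k.sig h.gam (m := 3) (by omega))) x := by
    refine setIntegral_congr_fun (isOpen_shell s t).measurableSet fun x hx => ?_
    simp only [density, hsymm x (shell_subset_spacetime hs.le ht'.le hx)]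
  simp only [slicePairing]
  linear_combination h1 - h2 - h3

theorem weylFlux_of_weylFree (hk : k.WeylFree) {t : ℝ} (ht : 1 < t) (ht' : t < 2) :
    weylFlux b t h k = 0 := by
  rw [weylFlux, sliceIntegral_congr (β := fun _ => 0) (by linarith) fun x hx => ?_]
  · simp [sliceIntegral]
  · have hx' : x ∈ spacetime := ⟨by rwa [hx], by rwa [hx]⟩
    ext v
    simp [pair, weylAct, wedge_apply, hk x hx']

theorem weylFlux_of_isPureGauge (hb : b.IsSelfDual Λ) (hh : h.IsPureGauge b)
    (hk : k.IsSolution Λ b) {t : ℝ} (ht : 1 < t) (ht' : t < 2) : weylFlux b t h k = 0 := by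
  obtain ⟨-, X, Y, θ, hX, hY, hθ, hg⟩ := hh
  have hβ : ContDiffOn ℝ ∞ (pair (raise (gaugeParameter b.Gam X Y θ)) (weylAct k.psi b.Sig)
      (m := 2) (by omega)) spacetime :=
    contDiffOn_pair _ (isSymmSmooth_raise
      (isSymmSmooth_gaugeParameter hb.gam_symm_smooth hX hY hθ))
      (isSymmSmooth_weylAct hk.psi_weyl hb.sig_symm_smooth)
  rw [weylFlux, sliceIntegral_congr (β := fun x => (-1 : ℂ) • extDeriv
    (pair (raise (gaugeParameter b.Gam X Y θ)) (weylAct k.psi b.Sig) (m := 2) (by omega)) x)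
    (by linarith) fun x hx => ?_]
  · rw [sliceIntegral_smul, sliceIntegral_extDeriv hβ ht ht', mul_zero]
  · rw [pair_weylAct_of_gauge hb hk hX hY hθ (fun x hx A B => (hg x hx A B).2)
      ⟨by rwa [hx], by rwa [hx]⟩]
    ext v
    simp

/-- For boundary conditions at both ends, the bulk integral is the symplectic product. -/
theorem hasBulkIntegral_symplectic (hb : b.IsSelfDual Λ) (hh : h.IsSolution Λ b)
    (hk : k.IsSolution Λ b) (hpast : Tendsto (fun t => slicePairing t h k) (𝓝[>] (1 : ℝ)) (𝓝 0))
    (hfut : Tendsto (fun t => slicePairing t k h) (𝓝[<] (2 : ℝ)) (𝓝 0)) {t : ℝ} (ht : 1 < t)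
    (ht' : t < 2) :
    HasBulkIntegral (bulkForm κ Λ b h k)
      (-(Complex.I / (κ : ℂ) ^ 2) * (slicePairing t h k - slicePairing t k h)) := by
  rw [← hasBulkIntegral_iff_tendsto hb hh hk hpast, HasAmplitude]
  unfold inner
  refine Tendsto.const_mul _ ?_
  -- By conservation the pairing at `s` is the fixed symplectic product plus the opposite pairing,
  -- which dies out in the future.
  have h1 : (fun s => slicePairing t h k - slicePairing t k h + slicePairing s k h)
      =ᶠ[𝓝[<] (2 : ℝ)] fun s => slicePairing s h k := by
    filter_upwards [Ioo_mem_nhdsLT (by norm_num : (1 : ℝ) < 2)] with s hs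
    rw [← slicePairing_sub_const hb hh hk hs.1 hs.2 ht ht', sub_add_cancel]
  refine Tendsto.congr' h1 ?_
  simpa using hfut.const_add (slicePairing t h k - slicePairing t k h)

theorem hasBulkIntegral_unique {η : E4 → Form 4} {I J : ℂ} (hI : HasBulkIntegral η I)
    (hJ : HasBulkIntegral η J) : I = J :=
  tendsto_nhds_unique hI hJ

/-- The bulk integral is a nonzero multiple of the conserved product `c`. In the past the pairing of
`h` with `k` vanishes, so the opposite pairing tends to `-c`. Both conditions thus say `c = 0`; the
slice 3/2 is an arbitrary interior one. -/
theorem hasBulkIntegral_zero_iff (hκ : κ ≠ 0) (hb : b.IsSelfDual Λ) (hh : h.IsSolution Λ b)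
    (hk : k.IsSolution Λ b) (hpast : Tendsto (fun t => slicePairing t h k) (𝓝[>] (1 : ℝ)) (𝓝 0))
    (hfut : Tendsto (fun t => slicePairing t k h) (𝓝[<] (2 : ℝ)) (𝓝 0)) :
    HasBulkIntegral (bulkForm κ Λ b h k) 0 ↔
      Tendsto (fun t => slicePairing t k h) (𝓝[>] (1 : ℝ)) (𝓝 0) := by
  have hc : -(Complex.I / (κ : ℂ) ^ 2) ≠ 0 := by simp [hκ]
  set c : ℂ := slicePairing (3 / 2) h k - slicePairing (3 / 2) k h
  have hB : HasBulkIntegral (bulkForm κ Λ b h k) (-(Complex.I / (κ : ℂ) ^ 2) * c) :=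
    hasBulkIntegral_symplectic hb hh hk hpast hfut (by norm_num) (by norm_num)
  have hQ : Tendsto (fun t => slicePairing t k h) (𝓝[>] (1 : ℝ)) (𝓝 (-c)) := by
    have h1 : (fun s => slicePairing s h k - c) =ᶠ[𝓝[>] (1 : ℝ)]
        fun s => slicePairing s k h := by
      filter_upwards [Ioo_mem_nhdsGT (by norm_num : (1 : ℝ) < 2)] with s hs
      have := slicePairing_sub_const hb hh hk hs.1 hs.2 (t := 3 / 2) (by norm_num) (by norm_num)
      simp only [c, ← this]
      ring
    refine Tendsto.congr' h1 ?_
    simpa using hpast.sub_const c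
  constructor
  · intro h0
    have : c = 0 := (mul_eq_zero.1 (hasBulkIntegral_unique hB h0)).resolve_left hc
    simpa [this] using hQ
  · intro h0
    have : c = 0 := neg_eq_zero.1 (tendsto_nhds_unique hQ h0)
    simpa [this] using hB

end

end MHV
end

/-! ### Assembly of the amplitude formula and the vanishing statements -/

theorem mainTheorem5 (κ Λ : ℝ) (hκ : 0 < κ) (hΛ : 0 < Λ)
    (b : MHV.Background) (hb : b.IsSelfDual Λ)
    (W : Set MHV.State) (hW : ∀ h ∈ W, h.IsSolution Λ b)
    (h₁ h₂ : MHV.State) (h₁W : h₁ ∈ W) (h₂W : h₂ ∈ W)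
    (h₁past : MHV.IsASDPast W h₁) :
    (∀ I : ℂ, MHV.HasAmplitude κ h₂ h₁ I ↔
      MHV.HasBulkIntegral (MHV.bulkForm κ Λ b h₁ h₂) I) ∧
    (IntegrableOn (MHV.density (MHV.bulkForm κ Λ b h₁ h₂)) MHV.spacetime →
      MHV.HasAmplitude κ h₂ h₁
        (∫ x in MHV.spacetime, MHV.density (MHV.bulkForm κ Λ b h₁ h₂) x)) ∧
    (MHV.IsASDFuture W h₂ →
      (h₁.IsPureGauge b ∨ h₂.IsPureGauge b →
        MHV.HasBulkIntegral (MHV.bulkForm κ Λ b h₁ h₂) 0) ∧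
      (h₁.WeylFree →
        (∀ t ∈ Set.Ioo (1 : ℝ) 2, MHV.HasBulkIntegral (MHV.bulkForm κ Λ b h₁ h₂)
          (-(3 * Complex.I / (Λ * κ ^ 2)) * MHV.weylFlux b t h₁ h₂)) ∧
        (MHV.HasBulkIntegral (MHV.bulkForm κ Λ b h₁ h₂) 0 ↔
          Tendsto (fun t => MHV.slicePairing t h₂ h₁) (𝓝[>] (1 : ℝ)) (𝓝 0))) ∧
      (h₂.WeylFree →
        ∀ t ∈ Set.Ioo (1 : ℝ) 2, MHV.HasBulkIntegral (MHV.bulkForm κ Λ b h₁ h₂)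
          ((3 * Complex.I / (Λ * κ ^ 2)) * MHV.weylFlux b t h₂ h₁))) := by
  have s₁ := hW h₁ h₁W
  have s₂ := hW h₂ h₂W
  have hpast := h₁past h₂ h₂W
  have hκ' : (κ : ℂ) ≠ 0 := by exact_mod_cast hκ.ne'
  have hΛ' : (Λ : ℂ) ≠ 0 := by exact_mod_cast hΛ.ne'
  have hiff := MHV.hasBulkIntegral_iff_tendsto (κ := κ) hb s₁ s₂ hpast
  refine ⟨hiff, fun hi => (hiff _).2 (MHV.hasBulkIntegral_of_integrableOn hi), fun h₂fut => ?_⟩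
  have hfut := h₂fut h₁ h₁W
  -- Dividing the flux identity by Λ/3 turns the prefactor i/κ² into 3i/(Λκ²).
  have key (t : ℝ) (ht : t ∈ Set.Ioo (1 : ℝ) 2) :
      MHV.HasBulkIntegral (MHV.bulkForm κ Λ b h₁ h₂) (-(3 * Complex.I / (Λ * κ ^ 2)) *
        (MHV.weylFlux b t h₁ h₂ - MHV.weylFlux b t h₂ h₁)) := by
    have h := MHV.hasBulkIntegral_symplectic (κ := κ) hb s₁ s₂ hpast hfut ht.1 ht.2
    rw [← MHV.slicePairing_sub hb s₁ s₂ ht.1 ht.2]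
    convert h using 1
    push_cast
    field_simp
  have first (hw : h₁.WeylFree) (t : ℝ) (ht : t ∈ Set.Ioo (1 : ℝ) 2) :
      MHV.HasBulkIntegral (MHV.bulkForm κ Λ b h₁ h₂)
        (-(3 * Complex.I / (Λ * κ ^ 2)) * MHV.weylFlux b t h₁ h₂) := by
    simpa [MHV.weylFlux_of_weylFree hw ht.1 ht.2] using key t ht
  have second (hw : h₂.WeylFree) (t : ℝ) (ht : t ∈ Set.Ioo (1 : ℝ) 2) :
      MHV.HasBulkIntegral (MHV.bulkForm κ Λ b h₁ h₂)
        ((3 * Complex.I / (Λ * κ ^ 2)) * MHV.weylFlux b t h₂ h₁) := by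
    simpa [MHV.weylFlux_of_weylFree hw ht.1 ht.2] using key t ht
  have hm : (3 / 2 : ℝ) ∈ Set.Ioo (1 : ℝ) 2 := by norm_num
  refine ⟨?_, fun hw => ⟨first hw, MHV.hasBulkIntegral_zero_iff hκ.ne' hb s₁ s₂ hpast hfut⟩,
    second⟩
  -- Pure gauge includes ψ = 0, so a single flux is left; it involves the gauge solution's γ and
  -- vanishes. Any slice would do.
  rintro (hg | hg)
  · simpa [MHV.weylFlux_of_isPureGauge hb hg s₂ hm.1 hm.2] using first hg.1 _ hm
  · simpa [MHV.weylFlux_of_isPureGauge hb hg s₁ hm.1 hm.2] using second hg.1 _ hm
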